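/- **Setting.** Let $N\ge 1$ be an integer, $K\in\{1,2,\dots\}\cup\{\infty\}$. For $I=(i_1,\dots,i_N)\in\mathbb N^N$ put $|I|=\sum_j i_j$, $I!=\prod_j i_j!$, and let $\mathcal I_k=\{I\in\mathbb N^N: |I|=2k\}$. For an $N\times N$ matrix $B$, $B_I$ is the $|I|\times|I|$ matrix obtained by repeating the $j$-th row and column of $B$ $i_j$ times. The hafnian of a $2m\times 2m$ matrix is $\mathrm{Haf}(M)=\frac{1}{m!2^m}\sum_{\sigma\in S_{2m}}\prod_{j=1}^m M_{\sigma(2j-1),\sigma(2j)}$ ($=1$ for the empty matrix). Let $\mathcal B$ be the set of real symmetric $N\times N$ matrices with strictly positive entries and all eigenvalues $\lambda_1,\dots,\lambda_N$ in $(0,1)$. For $B\in\mathcal B$ let $b_{\max},b_{\min}$ be its largest and smallest entry and $d=\prod_j\sqrt{1-\lambda_j^2}$. Let $\mathcal A=\prod_{k=0}^K\mathbb R_{\ge0}^{\mathcal I_k}$. It carries the product topology if $K<\infty$ and the box topology (all products of open sets are open) if $K=\infty$. For $a=(a_I)\in\mathcal A$ put $$\mu=\sum_{k=0}^K\sum_{|I|=2k}a_I\,\mathrm{Haf}(B_I),\qquad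 Q^{\text{GBS-P}}=\frac1d\sum_{k_1,k_2=0}^K\ \sum_{|I|=2k_1,\,|J|=2k_2}a_Ia_J\,J!\,\frac{\mathrm{Haf}(B_I)}{\mathrm{Haf}(B_J)},$$ $$Q^{\text{MC}}=\sum_{k_1,k_2=0}^K\ \sum_{|I|=2k_1,\,|J|=2k_2}a_Ia_J\,\mathrm{Haf}(B_{I+J}).$$ For $0<\epsilon,\delta<1$ the guaranteed sample sizes of the GBS probability estimator and of plain Monte Carlo are $$n^{\text{GBS-P}}_{\mathrm{Haf}}=\frac{Q^{\text{GBS-P}}-\mu^2}{\delta\epsilon^2\mu^2},\qquad n^{\text{MC}}_{\mathrm{Haf}}=\frac{Q^{\text{MC}}-\mu^2}{\delta\epsilon^2\mu^2}.$$ Let $\mathcal A_B$ be the set of $a\in\mathcal A$ with $0\ne\mu<\infty$, $Q^{\text{GBS-P}}<\infty$ and $Q^{\text{MC}}<\infty$, and let $\mathcal P=\bigcup_{B\in\mathcal B}\mathcal A_B\times\{B\}\subseteq\mathcal A\times\mathcal B$ with the subspace topology. **Auxiliary functions.** $\mathrm{Li}_{s,K}(z)=\sum_{k=1}^K z^k/k^s$.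 For $k\ge1$ write $2k=Ns_k+r_k$ with integers $s_k\ge 0$, $1\le r_k\le N$; $s_\infty=\infty$; $m_k=(s_k!)^N(s_k+1)^{r_k}$. With $q^-=\min(q,0)$, $$G_{q,K,N}(z)=\sum_{k=1}^{\lfloor N/2\rfloor}\frac{k^q}{(2k)!}z^{2k}+2^{-q^-}(2\pi)^{\frac{N-1}2}N^{q-\frac12}e^{\frac N{12}}\,\mathrm{Li}_{0,N}\!\Big(\frac{2z}N\Big)\mathrm{Li}_{\frac12-\frac N2-q,\,s_K}\!\Big(\frac{z^N}{N^N}\Big),$$ $R_{q,K}(z)=\frac{2^{-q}}{2\sqrt\pi}\mathrm{Li}_{\frac12-q,K}(z)$ if $q\ge0$ and $R_{q,K}(z)=\frac1{2\sqrt\pi}\mathrm{Li}_{\frac12-2q,K}(z)$ if $q<0$. Given $s_1,s_2,\gamma_\alpha,\gamma_\beta>0$ and $q_\alpha,q_\beta\in\mathbb R$, let $$c_1=1+\tfrac1{\sqrt\pi}e^{\frac1{25}-\frac16}\mathrm{Li}_{\frac12-q_\alpha,K}(2\gamma_\alpha b_{\min}),\qquad c_2=1+\tfrac1{\sqrt\pi}\mathrm{Li}_{\frac12-q_\beta,K}(2\gamma_\beta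 b_{\max}),$$ and let $\mathcal B_{\alpha,\beta}$ be the set of $B\in\mathcal B$ such that 1. $c_2^{-1}<c_1^{-1}$, and $c_2^{-1}k^{q_\alpha}\gamma_\alpha^k<c_1^{-1}k^{q_\beta}\gamma_\beta^k$ for all integers $1\le k\le K$; 2. $\displaystyle\frac{s_1}{\epsilon^2\delta}\frac{c_1^{-1}}d\Big(1+G_{q_\beta,K,N}\big(\sqrt{2\gamma_\beta b_{\min}^{-1}}\big)\Big)\le\ln\!\Big(1+2e^{\frac1{25}-\frac16}R_{q_\alpha,K}(4\gamma_\alpha b_{\min})\Big)+2\ln(c_2^{-1})-\ln(\epsilon^2\delta+1)+\frac{s_1}{\epsilon^2\delta}-\ln\max(s_2,1);$ 3. if $K=\infty$: $4\gamma_\beta b_{\max}<1$ and $2\gamma_\beta b_{\min}^{-1}<N^2$. **Conditions on $a\in\mathcal A$.** Some $a_I\neq0$; $c_2^{-1}\mu<a_0<c_1^{-1}\mu$; and for all integers $1\le k\le K$ $$c_2^{-1}\mu\frac{k^{q_\alpha}\gamma_\alpha^k}{k!}\le\sum_{|I|=2k}a_I\le c_1^{-1}\mu\frac{k^{q_\beta}\gamma_\beta^k}{k!},\qquad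 \sum_{|I|=2k}a_I\,I!\le c_1^{-1}\mu\frac{k^{q_\beta}\gamma_\beta^k}{k!}m_k.\tag{$*$}$$ (These conditions include that $\mu$ is finite.) **Theorem.** Let $N\ge1$, $0<\epsilon,\delta<1$ and $s_1,s_2>0$. (i) Let $K\in\{1,2,\dots\}\cup\{\infty\}$, $\gamma_\alpha,\gamma_\beta>0$, $q_\alpha,q_\beta\in\mathbb R$. If $B\in\mathcal B_{\alpha,\beta}$ and $a\in\mathcal A$ satisfies the conditions above, then $a\in\mathcal A_B$ (so both sample sizes are well defined and finite) and $$s_2\exp\!\big(s_1\,n^{\text{GBS-P}}_{\mathrm{Haf}}\big)<n^{\text{MC}}_{\mathrm{Haf}}<\infty.$$ (ii) For all sufficiently large $K$ (including $K=\infty$) there are $\gamma_\alpha,\gamma_\beta>0$, $q_\alpha,q_\beta\in\mathbb R$ and a non-empty open subset $U$ of $\mathcal P$ such that every $(a,B)\in U$ satisfies $B\in\mathcal B_{\alpha,\beta}$ and the conditions on $a$ above. -/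

import Mathlib

open scoped Nat BigOperators

noncomputable section

namespace GaussExp

/-! ### Multi-indices, hafnians -/

/-- The truncation levels `0 ≤ k ≤ K`, where `K` is a natural number or `∞`. -/
abbrev Level (K : ℕ∞) : Type := {k : ℕ // (k : ℕ∞) ≤ K}

/-- The multi-indices `I ∈ ℕ^N` with `|I| = 2k`. -/
abbrev Idx (N k : ℕ) : Type := {I : Fin N → ℕ // ∑ i, I i = 2 * k}

instance instFintypeIdx (N k : ℕ) : Fintype (Idx N k) :=
  Fintype.subtype (Finset.piAntidiag (Finset.univ : Finset (Fin N)) (2 * k)) (by simp)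

/-- `I! = i_1! ⋯ i_N!`. -/
def multiFactorial {N : ℕ} (I : Fin N → ℕ) : ℝ := ∏ i, ((I i)! : ℝ)

/-- The hafnian of an `n × n` matrix: with `n = 2m` it is
`(1 / (m! 2^m)) ∑_σ ∏_{j=1}^m M_{σ(2j-1), σ(2j)}`; it is `0` for odd `n`, and `1` for `n = 0`. -/
def hafnian {n : ℕ} (M : Matrix (Fin n) (Fin n) ℝ) : ℝ :=
  if Even n then
    (1 / (((n / 2)! : ℝ) * 2 ^ (n / 2))) *
      ∑ σ : Equiv.Perm (Fin n), ∏ j : Fin (n / 2),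
        M (σ ⟨2 * (j : ℕ), by have := j.2; omega⟩) (σ ⟨2 * (j : ℕ) + 1, by have := j.2; omega⟩)
  else 0

/-- The `|I| × |I|` matrix `B_I`, in which row and column `m` of `B` are repeated `i_m` times. -/
def repeatMatrix {N : ℕ} (B : Matrix (Fin N) (Fin N) ℝ) (I : Fin N → ℕ) :
    Matrix (Fin (∑ i, I i)) (Fin (∑ i, I i)) ℝ :=
  fun p q => B (finSigmaFinEquiv.symm p).1 (finSigmaFinEquiv.symm q).1

/-- `Haf(B_I)`. -/
def hafRep {N : ℕ} (B : Matrix (Fin N) (Fin N) ℝ) (I : Fin N → ℕ) : ℝ :=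
  hafnian (repeatMatrix B I)

/-! ### The matrices -/

/-- The largest absolute value of an entry. -/
def bMax {N : ℕ} (B : Matrix (Fin N) (Fin N) ℝ) : ℝ := ⨆ p : Fin N × Fin N, |B p.1 p.2|

/-- The smallest entry. -/
def bMin {N : ℕ} (B : Matrix (Fin N) (Fin N) ℝ) : ℝ := ⨅ p : Fin N × Fin N, B p.1 p.2

/-- `d = ∏_j √(1 - λ_j²)`, over the eigenvalues of `B` with multiplicity. -/
def dConst {N : ℕ} (B : Matrix (Fin N) (Fin N) ℝ) : ℝ :=
  (B.charpoly.roots.map fun l => √(1 - l ^ 2)).prod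

/-- The space `𝓑`: symmetric matrices with positive entries and spectrum in `(0, 1)`. -/
def matrixSpace (N : ℕ) : Set (Matrix (Fin N) (Fin N) ℝ) :=
  {B | (∀ i j, 0 < B i j) ∧ B.IsSymm ∧ ∀ l ∈ spectrum ℝ B, 0 < l ∧ l < 1}

/-! ### The coefficients -/

/-- The box topology on a product: all products of open sets are open. -/
@[reducible] def boxTopology {ι : Type*} (X : ι → Type*) [∀ i, TopologicalSpace (X i)] :
    TopologicalSpace (∀ i, X i) :=
  TopologicalSpace.generateFrom
    {s | ∃ u : ∀ i, Set (X i), (∀ i, IsOpen (u i)) ∧ s = Set.univ.pi u}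

/-- With finitely many factors the box topology is the product topology. -/
theorem boxTopology_eq_pi {ι : Type*} [Finite ι] (X : ι → Type*)
    [∀ i, TopologicalSpace (X i)] : boxTopology X = Pi.topologicalSpace := by
  apply le_antisymm
  · rw [pi_eq_generateFrom]
    refine le_generateFrom ?_
    rintro _ ⟨s, F, hs, rfl⟩
    classical
    refine TopologicalSpace.isOpen_generateFrom_of_mem
      ⟨fun i => if i ∈ F then s i else Set.univ, fun i => ?_, ?_⟩
    · by_cases h : i ∈ F
      · simpa [h] using hs i h
      · simp [h]
    · ext x
      simp only [Set.mem_pi, Set.mem_univ, true_imp_iff, Finset.mem_coe]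
      refine forall_congr' fun i => ?_
      by_cases h : i ∈ F <;> simp [h]
  · refine le_generateFrom ?_
    rintro _ ⟨u, hu, rfl⟩
    exact isOpen_set_pi Set.finite_univ fun i _ => hu i

/-- Real coefficient families `(a_I)`, `|I| = 2k`, `0 ≤ k ≤ K`, i.e. `∏_{k=0}^K ℝ^{𝓘_k}`. -/
def Coeff (N : ℕ) (K : ℕ∞) : Type := (k : Level K) → Idx N k.1 → ℝ

/-- For `K < ∞` this is the product topology (`boxTopology_eq_pi`). -/
instance instTopologicalSpaceCoeff (N : ℕ) (K : ℕ∞) : TopologicalSpace (Coeff N K) :=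
  boxTopology fun k : Level K => Idx N k.1 → ℝ

variable {N : ℕ} {K : ℕ∞}

/-- The family has nonnegative entries. -/
def Nonneg (a : Coeff N K) : Prop := ∀ k I, 0 ≤ a k I

/-- The coefficient `a_0` of the zero multi-index. -/
def coeffZero (a : Coeff N K) : ℝ := a ⟨0, by simp⟩ ⟨0, by simp⟩

/-- The terms `∑_{|I|=2k} a_I Haf(B_I)` of `μ_Haf`. -/
def muTerm (a : Coeff N K) (B : Matrix (Fin N) (Fin N) ℝ) (k : Level K) : ℝ :=
  ∑ I, a k I * hafRep B I.1

/-- `μ_Haf`. -/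
def muHaf (a : Coeff N K) (B : Matrix (Fin N) (Fin N) ℝ) : ℝ := ∑' k, muTerm a B k

/-- The terms of `Q^{GBS-P}`, before division by `d`. -/
def gbspTerm (a : Coeff N K) (B : Matrix (Fin N) (Fin N) ℝ) (p : Level K × Level K) : ℝ :=
  ∑ I, ∑ J, a p.1 I * a p.2 J * multiFactorial J.1 * (hafRep B I.1 / hafRep B J.1)

/-- `Q^{GBS-P}_Haf`. -/
def qGBSP (a : Coeff N K) (B : Matrix (Fin N) (Fin N) ℝ) : ℝ :=
  (1 / dConst B) * ∑' p, gbspTerm a B p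

/-- The terms of `Q^{MC}`. -/
def mcTerm (a : Coeff N K) (B : Matrix (Fin N) (Fin N) ℝ) (p : Level K × Level K) : ℝ :=
  ∑ I, ∑ J, a p.1 I * a p.2 J * hafRep B (I.1 + J.1)

/-- `Q^{MC}_Haf`. -/
def qMC (a : Coeff N K) (B : Matrix (Fin N) (Fin N) ℝ) : ℝ := ∑' p, mcTerm a B p

/-- The guaranteed sample size `n^{GBS-P}_Haf`. -/
def nGBSP (ε δ : ℝ) (a : Coeff N K) (B : Matrix (Fin N) (Fin N) ℝ) : ℝ :=
  (qGBSP a B - muHaf a B ^ 2) / (δ * ε ^ 2 * muHaf a B ^ 2)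

/-- The guaranteed sample size `n^{MC}_Haf`. -/
def nMC (ε δ : ℝ) (a : Coeff N K) (B : Matrix (Fin N) (Fin N) ℝ) : ℝ :=
  (qMC a B - muHaf a B ^ 2) / (δ * ε ^ 2 * muHaf a B ^ 2)

/-- The space `𝓐_B` of nonnegative families for which `μ_Haf ≠ 0` and the series defining
`μ_Haf`, `Q^{GBS-P}_Haf` and `Q^{MC}_Haf` are finite, so that the problem and both guaranteed
sample sizes are well defined and finite. -/
def coeffSpace (K : ℕ∞) (B : Matrix (Fin N) (Fin N) ℝ) : Set (Coeff N K) :=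
  {a | Nonneg a ∧ Summable (muTerm a B) ∧ muHaf a B ≠ 0 ∧
    Summable (gbspTerm a B) ∧ Summable (mcTerm a B)}

/-- The problem space `𝓟 = ⋃_{B ∈ 𝓑} 𝓐_B × {B}`. -/
def problemSpace (N : ℕ) (K : ℕ∞) : Set (Coeff N K × Matrix (Fin N) (Fin N) ℝ) :=
  {p | p.2 ∈ matrixSpace N ∧ p.1 ∈ coeffSpace K p.2}

/-! ### The comparison functions -/

open Classical in
/-- The truncated polylogarithm `Li_{s,K}(z) = ∑_{k=1}^K z^k / k^s`, `K ≤ ∞`. -/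
def polylog (s : ℝ) (K : ℕ∞) (z : ℝ) : ℝ :=
  ∑' k : ℕ, if 1 ≤ k ∧ (k : ℕ∞) ≤ K then z ^ k / (k : ℝ) ^ s else 0

/-- The integer `s_k` with `2k = N s_k + r_k`, `1 ≤ r_k ≤ N`, for `k ≥ 1` (and `s_0 = 0`). -/
def sIdx (N k : ℕ) : ℕ := (2 * k - 1) / N

/-- The integer `r_k` with `2k = N s_k + r_k`, `1 ≤ r_k ≤ N`, for `k ≥ 1` (and `r_0 = 0`). -/
def rIdx (N k : ℕ) : ℕ := 2 * k - N * sIdx N k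

/-- `s_K`, with `s_∞ = ∞`. -/
def sTop (N : ℕ) (K : ℕ∞) : ℕ∞ := ENat.map (sIdx N) K

/-- `m_k = (s_k!)^N (s_k + 1)^{r_k}`. -/
def mIdx (N k : ℕ) : ℝ := ((sIdx N k)! : ℝ) ^ N * ((sIdx N k : ℝ) + 1) ^ rIdx N k

/-- `∑_{k=1}^n k^q z^{2k} / (2k)!`. -/
def hFun (q : ℝ) (n : ℕ) (z : ℝ) : ℝ :=
  ∑ k ∈ Finset.Icc 1 n, (k : ℝ) ^ q / ((2 * k)! : ℝ) * z ^ (2 * k)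

/-- The function `G_{q,K,N}`. -/
def gFun (q : ℝ) (K : ℕ∞) (N : ℕ) (z : ℝ) : ℝ :=
  hFun q (N / 2) z +
    (2 : ℝ) ^ (-min q 0) * (2 * Real.pi) ^ (((N : ℝ) - 1) / 2) * (N : ℝ) ^ (q - 1 / 2) *
      Real.exp ((N : ℝ) / 12) * polylog 0 (N : ℕ∞) (2 * z / N) *
      polylog (1 / 2 - (N : ℝ) / 2 - q) (sTop N K) (z ^ N / (N : ℝ) ^ N)

/-- The function `R_{q,K}`. -/
def rFun (q : ℝ) (K : ℕ∞) (z : ℝ) : ℝ :=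
  if 0 ≤ q then (2 : ℝ) ^ (-q) * (1 / (2 * √Real.pi)) * polylog (1 / 2 - q) K z
  else 1 / (2 * √Real.pi) * polylog (1 / 2 - 2 * q) K z

/-- The constant `e^{1/25 - 1/6}`. -/
def eConst : ℝ := Real.exp (1 / 25 - 1 / 6)

/-- The constant `c_1`. -/
def cOne (K : ℕ∞) (γα qα : ℝ) (B : Matrix (Fin N) (Fin N) ℝ) : ℝ :=
  1 + 1 / √Real.pi * eConst * polylog (1 / 2 - qα) K (2 * γα * bMin B)

/-- The constant `c_2`. -/
def cTwo (K : ℕ∞) (γβ qβ : ℝ) (B : Matrix (Fin N) (Fin N) ℝ) : ℝ :=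
  1 + 1 / √Real.pi * polylog (1 / 2 - qβ) K (2 * γβ * bMax B)

/-- The set `𝓑_{α,β}`. -/
def matrixSubset (N : ℕ) (K : ℕ∞) (ε δ s₁ s₂ γα γβ qα qβ : ℝ) :
    Set (Matrix (Fin N) (Fin N) ℝ) :=
  {B | B ∈ matrixSpace N ∧
    (cTwo K γβ qβ B)⁻¹ < (cOne K γα qα B)⁻¹ ∧
    (∀ k : ℕ, 1 ≤ k → (k : ℕ∞) ≤ K →
      (cTwo K γβ qβ B)⁻¹ * ((k : ℝ) ^ qα * γα ^ k) <
        (cOne K γα qα B)⁻¹ * ((k : ℝ) ^ qβ * γβ ^ k)) ∧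
    s₁ / (ε ^ 2 * δ) * ((cOne K γα qα B)⁻¹ / dConst B) *
        (1 + gFun qβ K N (√(2 * γβ * (bMin B)⁻¹))) ≤
      Real.log (1 + 2 * eConst * rFun qα K (4 * γα * bMin B)) +
        2 * Real.log (cTwo K γβ qβ B)⁻¹ - Real.log (ε ^ 2 * δ + 1) +
        s₁ / (ε ^ 2 * δ) - Real.log (max s₂ 1) ∧
    (K = ⊤ → 4 * γβ * bMax B < 1 ∧ 2 * γβ * (bMin B)⁻¹ < (N : ℝ) ^ 2)}

/-- The conditions on the coefficients. -/
def CoeffConditions (γα γβ qα qβ : ℝ) (a : Coeff N K) (B : Matrix (Fin N) (Fin N) ℝ) : Prop :=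
  (∃ k I, a k I ≠ 0) ∧
  (cTwo K γβ qβ B)⁻¹ * muHaf a B < coeffZero a ∧
  coeffZero a < (cOne K γα qα B)⁻¹ * muHaf a B ∧
  ∀ k : Level K, 1 ≤ k.1 →
    (cTwo K γβ qβ B)⁻¹ * muHaf a B * ((k.1 : ℝ) ^ qα * γα ^ k.1 / (k.1 ! : ℝ)) ≤ ∑ I, a k I ∧
    ∑ I, a k I ≤
      (cOne K γα qα B)⁻¹ * muHaf a B * ((k.1 : ℝ) ^ qβ * γβ ^ k.1 / (k.1 ! : ℝ)) ∧
    ∑ I, a k I * multiFactorial I.1 ≤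
      (cOne K γα qα B)⁻¹ * muHaf a B * ((k.1 : ℝ) ^ qβ * γβ ^ k.1 / (k.1 ! : ℝ)) * mIdx N k.1

end GaussExp

end

/-! For `|I| = 2k`, `Haf(B_I)` lies between `b_min^k (2k - 1)‼` and `b_max^k (2k - 1)‼`. At most
`I!` permutations realise a given word of row indices, so `Haf(B_I)` is also at most
`I! (∑ B_ij)^k / (k! 2^k)`, and `N² b_min ≤ ∑ B_ij ≤ N` turns this into
`Haf(B_I) ≤ I! / (b_min^k (2k - 1)‼)`. Hence `∑ a_I I! / Haf(B_I)` and `μ` are both at most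
`c_1⁻¹ μ (1 + G)`, where `G` comes from Stirling's formula for `m_k / (2k)!`, and
`Q^{GBS-P} ≤ c_1⁻¹ μ² (1 + G) / d`. On the other side, grouping the levels `k + l = n` and using
`∑ 1 / (k! l!) = 2^n / n!` and `(2n - 1)‼ = binom(2n, n) 4^{-n} 2^n n!` yields
`Q^{MC} ≥ c_2⁻² μ² (1 + 2 e^{1/25 - 1/6} R)`. Condition 2 compares the two bounds on a logarithmic
scale.

For the open set take `B` with nearly constant entries close to `b`, `q_α = q_β = 0` and one
`γ = γ_α = γ_β` with `4γb` slightly below `1`: then `R` is a partial sum of `∑ k^{-1/2} (4γb)^k` and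
can be made large with `K`, while the other terms of condition 2 stay bounded. If the level sums of
`a` are `γ^k / k!`, then `μ` is close to `∑ binom(2k, k) (γb/2)^k`, which lies strictly between
`c_1` and `c_2`; the gaps leave room for a relative error that is the same at every level. -/

noncomputable section

namespace GaussExp

open Finset

section CentralRatio

/-- The ratio `binom(2n, n) / 4^n`: hafnians with constant entries and the convolution of
`b^n / n!` with itself both produce it, and it lies between constant multiples of `1 / √n`. -/
def centralRatio (n : ℕ) : ℝ := (n.centralBinom : ℝ) / 4 ^ n

theorem centralRatio_pos (n : ℕ) : 0 < centralRatio n :=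
  div_pos (by exact_mod_cast n.centralBinom_pos) (by positivity)

theorem centralRatio_zero : centralRatio 0 = 1 := by simp [centralRatio]

theorem centralRatio_one : centralRatio 1 = 1 / 2 := by
  norm_num [centralRatio, Nat.centralBinom, Nat.choose]

theorem centralRatio_le_one (n : ℕ) : centralRatio n ≤ 1 :=
  div_le_one_of_le₀ (by exact_mod_cast n.centralBinom_le_four_pow) (by positivity)

theorem centralRatio_succ (n : ℕ) :
    centralRatio (n + 1) = centralRatio n * ((2 * n + 1) / (2 * n + 2)) := by
  have h : ((n + 1 : ℕ) : ℝ) * (n + 1).centralBinom = 2 * (2 * n + 1) * n.centralBinom := by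
    exact_mod_cast n.succ_mul_centralBinom_succ
  rw [centralRatio, centralRatio, pow_succ]
  push_cast at h
  field_simp
  linear_combination 2 * h

theorem factorial_two_mul_eq_centralRatio_mul (n : ℕ) :
    ((2 * n)! : ℝ) = centralRatio n * (2 ^ n * n !) ^ 2 := by
  have h : ((2 * n)! : ℝ) = n.centralBinom * n ! * n ! := by
    have := Nat.choose_mul_factorial_mul_factorial (show n ≤ 2 * n by omega)
    rw [two_mul, Nat.add_sub_cancel, ← two_mul] at this
    exact_mod_cast this.symm
  have h4 : ((2 : ℝ) ^ n) ^ 2 = 4 ^ n := by rw [← pow_mul, mul_comm, pow_mul]; norm_num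
  rw [h, centralRatio, mul_pow, h4]
  field_simp

theorem factorial_two_mul_eq_doubleFactorial_mul (n : ℕ) :
    (2 * n)! = (2 * n - 1)‼ * (2 ^ n * n !) := by
  obtain rfl | n := n
  · simp
  · rw [← Nat.doubleFactorial_two_mul, show 2 * (n + 1) = 2 * n + 1 + 1 by ring,
      Nat.factorial_eq_mul_doubleFactorial, Nat.add_sub_cancel, mul_comm]

theorem doubleFactorial_eq_centralRatio_mul (n : ℕ) :
    ((2 * n - 1)‼ : ℝ) = centralRatio n * (2 ^ n * n !) := by
  have h : ((2 * n)! : ℝ) = (2 * n - 1)‼ * (2 ^ n * n !) := by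
    exact_mod_cast factorial_two_mul_eq_doubleFactorial_mul n
  rw [factorial_two_mul_eq_centralRatio_mul, pow_two, ← mul_assoc] at h
  exact (mul_right_cancel₀ (by positivity) h).symm

theorem doubleFactorial_le (n : ℕ) : ((2 * n - 1)‼ : ℝ) ≤ 2 ^ n * n ! := by
  rw [doubleFactorial_eq_centralRatio_mul]
  exact mul_le_of_le_one_left (by positivity) (centralRatio_le_one n)

theorem le_mul_centralRatio_sq {n : ℕ} (hn : 1 ≤ n) : 1 / 4 ≤ n * centralRatio n ^ 2 := by
  induction n, hn using Nat.le_induction with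
  | base => norm_num [centralRatio_one]
  | succ n hn ih =>
    have h : (n : ℝ) ≤ (n + 1 : ℕ) * ((2 * n + 1) ^ 2 / (2 * n + 2) ^ 2) := by
      rw [← mul_div_assoc, le_div_iff₀ (by positivity)]
      push_cast
      nlinarith [(Nat.cast_nonneg n : (0 : ℝ) ≤ n)]
    calc 1 / 4 ≤ (n : ℝ) * centralRatio n ^ 2 := ih
      _ ≤ ((n + 1 : ℕ) * ((2 * n + 1) ^ 2 / (2 * n + 2) ^ 2)) * centralRatio n ^ 2 := by gcongr
      _ = (n + 1 : ℕ) * centralRatio (n + 1) ^ 2 := by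
        rw [centralRatio_succ, mul_pow, div_pow]
        ring

theorem wallis_eq_inv_centralRatio_sq (n : ℕ) :
    Real.Wallis.W n = (centralRatio n ^ 2 * (2 * n + 1))⁻¹ := by
  have h2 : (2 : ℝ) ^ (4 * n) = (2 ^ n) ^ 4 := by rw [← pow_mul, mul_comm]
  have hc := centralRatio_pos n
  rw [Real.Wallis.W_eq_factorial_ratio, factorial_two_mul_eq_centralRatio_mul, h2]
  field_simp

theorem mul_centralRatio_sq_le (n : ℕ) : n * centralRatio n ^ 2 ≤ 1 / Real.pi := by
  have hc := centralRatio_pos n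
  have hπ := Real.pi_pos
  have hW : centralRatio n ^ 2 * Real.pi * (2 * n + 1) ^ 2 ≤ 4 * (n + 1) := by
    have h := Real.Wallis.le_W n
    rw [wallis_eq_inv_centralRatio_sq, ← one_div, le_div_iff₀ (by positivity),
      div_mul_div_comm, div_mul_eq_mul_div, div_le_one (by positivity)] at h
    linear_combination h
  rw [le_div_iff₀ hπ]
  refine le_of_mul_le_mul_right (a := 4 * ((n : ℝ) + 1)) ?_ (by positivity)
  calc n * centralRatio n ^ 2 * Real.pi * (4 * (n + 1))
      = centralRatio n ^ 2 * Real.pi * (4 * n * (n + 1)) := by ring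
    _ ≤ centralRatio n ^ 2 * Real.pi * (2 * n + 1) ^ 2 := by gcongr; linarith
    _ ≤ 1 * (4 * (n + 1)) := by rwa [one_mul]

theorem inv_two_mul_sqrt_le_centralRatio {n : ℕ} (hn : 1 ≤ n) : 1 / 2 / √n ≤ centralRatio n := by
  have hn' : (0 : ℝ) < n := by exact_mod_cast hn
  rw [div_le_iff₀ (Real.sqrt_pos.2 hn')]
  refine le_of_sq_le_sq ?_ (mul_nonneg (centralRatio_pos n).le (Real.sqrt_nonneg _))
  rw [mul_pow, Real.sq_sqrt hn'.le]
  linarith [le_mul_centralRatio_sq hn]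

theorem centralRatio_le {n : ℕ} (hn : 1 ≤ n) : centralRatio n ≤ 1 / √Real.pi / √n := by
  have hn' : (0 : ℝ) < n := by exact_mod_cast hn
  rw [le_div_iff₀ (Real.sqrt_pos.2 hn')]
  refine le_of_sq_le_sq ?_ (by positivity)
  rw [mul_pow, Real.sq_sqrt hn'.le, div_pow, Real.sq_sqrt Real.pi_pos.le]
  linarith [mul_centralRatio_sq_le n]

theorem eConst_pos : 0 < eConst := Real.exp_pos _

theorem eConst_lt : eConst < √Real.pi / 2 := by
  have h_inv : eConst * Real.exp (19 / 150) = 1 := by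
    rw [eConst, ← Real.exp_add]; norm_num
  have h_exp := Real.quadratic_le_exp_of_nonneg (x := 19 / 150) (by norm_num)
  have h_sqrt : (1.77 : ℝ) < √Real.pi := by
    rw [Real.lt_sqrt (by norm_num)]
    have := Real.pi_gt_d2
    norm_num at this ⊢
    linarith
  nlinarith [eConst_pos]

theorem inv_sqrt_pi_mul_eConst_lt : 1 / √Real.pi * eConst < 1 / 2 := by
  rw [one_div, inv_mul_lt_iff₀ (Real.sqrt_pos.2 Real.pi_pos)]
  linarith [eConst_lt]

theorem inv_sqrt_pi_mul_eConst_pos : 0 < 1 / √Real.pi * eConst :=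
  mul_pos (one_div_pos.2 (Real.sqrt_pos.2 Real.pi_pos)) eConst_pos

theorem eConst_div_lt_centralRatio {n : ℕ} (hn : 1 ≤ n) :
    1 / √Real.pi * eConst / √n < centralRatio n :=
  (div_lt_div_of_pos_right inv_sqrt_pi_mul_eConst_lt
    (Real.sqrt_pos.2 (by exact_mod_cast hn))).trans_le (inv_two_mul_sqrt_le_centralRatio hn)

end CentralRatio

section Stirling

theorem exp_eleven_twelfths_le : Real.exp (11 / 12) ≤ √(2 * Real.pi) := by
  refine Real.le_sqrt_of_sq_le (le_of_pow_le_pow_left₀ (n := 6) (by norm_num) (by positivity) ?_)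
  calc (Real.exp (11 / 12) ^ 2) ^ 6 = Real.exp 1 ^ 11 := by
        simp only [← Real.exp_nat_mul]
        norm_num
    _ ≤ 2.7182818286 ^ 11 := by
        gcongr
        exact Real.exp_one_lt_d9.le
    _ ≤ (2 * 3.14) ^ 6 := by norm_num
    _ ≤ (2 * Real.pi) ^ 6 := by
        gcongr
        exact Real.pi_gt_d2.le

theorem stirlingSeq_one_le : Stirling.stirlingSeq 1 ≤ √Real.pi * Real.exp (1 / 12) := by
  rw [Stirling.stirlingSeq_one, div_le_iff₀ (by positivity)]
  calc Real.exp 1 = Real.exp (11 / 12) * Real.exp (1 / 12) := by rw [← Real.exp_add]; norm_num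
    _ ≤ √(2 * Real.pi) * Real.exp (1 / 12) := by gcongr; exact exp_eleven_twelfths_le
    _ = √Real.pi * Real.exp (1 / 12) * √2 := by rw [Real.sqrt_mul (by norm_num)]; ring

theorem factorial_le_stirling {s : ℕ} (hs : 1 ≤ s) :
    (s ! : ℝ) ≤ √(2 * Real.pi * s) * (s / Real.exp 1) ^ s * Real.exp (1 / 12) := by
  have h_anti : Stirling.stirlingSeq s ≤ Stirling.stirlingSeq 1 := by
    simpa [Nat.succ_eq_add_one, Nat.sub_add_cancel hs] using
      Stirling.stirlingSeq'_antitone (Nat.zero_le (s - 1))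
  have h := h_anti.trans stirlingSeq_one_le
  have hs' : (0 : ℝ) < s := by exact_mod_cast hs
  rw [Stirling.stirlingSeq, div_le_iff₀ (by positivity)] at h
  refine h.trans_eq ?_
  rw [show 2 * Real.pi * s = Real.pi * (2 * s) by ring, Real.sqrt_mul Real.pi_pos.le]
  ring

end Stirling

section Permutations

theorem sum_prod_pairs {α ι κ R : Type*} [Fintype α] [DecidableEq α] [Fintype ι] [Fintype κ]
    [CommSemiring R] (e : κ × Fin 2 ≃ α) (B : ι → ι → R) :
    ∑ g : α → ι, ∏ j, B (g (e (j, 0))) (g (e (j, 1))) = (∑ i, ∑ j, B i j) ^ Fintype.card κ := by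
  classical
  let E : (α → ι) ≃ (κ → ι × ι) :=
    (e.symm.arrowCongr (Equiv.refl ι)).trans <| (Equiv.curry κ (Fin 2) ι).trans <|
      (Equiv.refl κ).arrowCongr (finTwoArrowEquiv ι)
  rw [← Fintype.sum_prod_type', ← card_univ, ← prod_const, prod_univ_sum, Fintype.piFinset_univ]
  exact Fintype.sum_equiv E _ _ fun g => rfl

variable {α ι : Type*} [Fintype α] [DecidableEq α] [Fintype ι] [DecidableEq ι]

theorem card_perm_comp_eq_le (f g : α → ι) :
    #{σ : Equiv.Perm α | f ∘ σ = g} ≤ ∏ i, (Fintype.card {a // f a = i})! := by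
  obtain h | ⟨σ₀, hσ₀⟩ := ({σ : Equiv.Perm α | f ∘ σ = g} : Finset _).eq_empty_or_nonempty
  · simp [h]
  · have hσ₀ : f ∘ σ₀ = g := by simpa using hσ₀
    -- Right translation by `σ₀⁻¹` carries the solutions of `f ∘ σ = g` into the stabilizer of `f`.
    rw [← DomMulAct.stabilizer_card f, Fintype.card_subtype]
    refine card_le_card_of_injOn (· * σ₀⁻¹) (fun σ hσ => ?_) (mul_left_injective σ₀⁻¹).injOn
    have hσ : f ∘ σ = f ∘ σ₀ := by simpa [hσ₀] using hσ
    suffices f ∘ (σ * σ₀⁻¹ : Equiv.Perm α) = f by simpa using this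
    ext a
    simpa using congrFun hσ (σ₀⁻¹ a)

theorem sum_perm_comp_le {M : Type*} [AddCommMonoid M] [PartialOrder M] [IsOrderedAddMonoid M]
    (f : α → ι) {F : (α → ι) → M} (hF : ∀ g, 0 ≤ F g) :
    ∑ σ : Equiv.Perm α, F (f ∘ σ) ≤ (∏ i, (Fintype.card {a // f a = i})!) • ∑ g, F g := by
  rw [← sum_fiberwise univ (fun σ : Equiv.Perm α => f ∘ σ), smul_sum]
  refine sum_le_sum fun g _ => ?_
  rw [sum_congr rfl (g := fun _ => F g) fun σ hσ => by rw [(mem_filter.1 hσ).2], sum_const]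
  exact nsmul_le_nsmul_left (hF g) (card_perm_comp_eq_le f g)

end Permutations

section Hafnian

variable {n k N : ℕ}

/-- The enumeration `(j, 0) ↦ 2j`, `(j, 1) ↦ 2j + 1` of `2k` points by `k` pairs, in the order in
which `hafnian` pairs the rows. -/
def pairEquiv (h : n = k * 2) : Fin k × Fin 2 ≃ Fin n :=
  finProdFinEquiv.trans (finCongr h.symm)

theorem hafnian_eq_sum_pairEquiv (h : n = k * 2) (M : Matrix (Fin n) (Fin n) ℝ) :
    hafnian M = (∑ σ : Equiv.Perm (Fin n), ∏ j : Fin k,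
      M (σ (pairEquiv h (j, 0))) (σ (pairEquiv h (j, 1)))) / (k ! * 2 ^ k) := by
  subst h
  have hk : k * 2 / 2 = k := by omega
  rw [hafnian, if_pos (by simp), one_div_mul_eq_div]
  congr 1
  · refine sum_congr rfl fun σ _ => Fintype.prod_equiv (finCongr hk) _ _ fun j => ?_
    congr 2 <;> ext <;> simp [pairEquiv, add_comm]
  · rw [hk]

theorem sum_perm_prod_const_div (h : n = k * 2) (b : ℝ) :
    (∑ _σ : Equiv.Perm (Fin n), ∏ _j : Fin k, b) / (k ! * 2 ^ k) = b ^ k * (2 * k - 1)‼ := by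
  have hfac : (n ! : ℝ) = (2 * k - 1)‼ * (2 ^ k * k !) := by
    rw [h, mul_comm k 2]
    exact_mod_cast factorial_two_mul_eq_doubleFactorial_mul k
  simp only [prod_const, sum_const, card_univ, Fintype.card_perm, Fintype.card_fin, nsmul_eq_mul,
    hfac]
  field_simp

theorem hafnian_le_of_le {M : Matrix (Fin n) (Fin n) ℝ} {b : ℝ} (h : n = k * 2)
    (h0 : ∀ i j, 0 ≤ M i j) (hb : ∀ i j, M i j ≤ b) : hafnian M ≤ b ^ k * (2 * k - 1)‼ := by
  rw [hafnian_eq_sum_pairEquiv h, ← sum_perm_prod_const_div h]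
  gcongr
  exacts [fun _ _ => h0 _ _, hb _ _]

theorem le_hafnian_of_le {M : Matrix (Fin n) (Fin n) ℝ} {b : ℝ} (h : n = k * 2)
    (h0 : 0 ≤ b) (hb : ∀ i j, b ≤ M i j) : b ^ k * (2 * k - 1)‼ ≤ hafnian M := by
  rw [hafnian_eq_sum_pairEquiv h, ← sum_perm_prod_const_div h]
  gcongr
  exact hb _ _

theorem multiFactorial_pos (I : Fin N → ℕ) : 0 < multiFactorial I :=
  prod_pos fun _ _ => by positivity

theorem card_fiber_finSigmaFinEquiv_symm (I : Fin N → ℕ) (i : Fin N) :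
    Fintype.card {p : Fin (∑ i, I i) // (finSigmaFinEquiv.symm p).1 = i} = I i := by
  rw [← Fintype.card_fin (I i)]
  exact Fintype.card_congr <| (finSigmaFinEquiv.symm.subtypeEquiv fun _ => Iff.rfl).trans
    (Equiv.sigmaSubtype (β := fun i => Fin (I i)) i)

theorem hafRep_le_multiFactorial_mul {B : Matrix (Fin N) (Fin N) ℝ} (hB : ∀ i j, 0 ≤ B i j)
    (I : Idx N k) :
    hafRep B I.1 ≤ multiFactorial I.1 * (∑ i, ∑ j, B i j) ^ k / (k ! * 2 ^ k) := by
  have hI : ∑ i, I.1 i = k * 2 := I.2.trans (mul_comm _ _)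
  rw [hafRep, hafnian_eq_sum_pairEquiv hI]
  gcongr
  have h := sum_perm_comp_le (fun p : Fin (∑ i, I.1 i) => (finSigmaFinEquiv.symm p).1)
    (F := fun g => ∏ j, B (g (pairEquiv hI (j, 0))) (g (pairEquiv hI (j, 1))))
    fun g => prod_nonneg fun _ _ => hB _ _
  rw [sum_prod_pairs (pairEquiv hI) B, Fintype.card_fin, nsmul_eq_mul] at h
  simp only [card_fiber_finSigmaFinEquiv_symm, Nat.cast_prod] at h
  exact h

end Hafnian

section Matrices

variable {N k : ℕ} {B : Matrix (Fin N) (Fin N) ℝ}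

theorem bMin_le (B : Matrix (Fin N) (Fin N) ℝ) (i j : Fin N) : bMin B ≤ B i j :=
  ciInf_le (f := fun p : Fin N × Fin N => B p.1 p.2) (Set.finite_range _).bddBelow (i, j)

theorem le_bMax (B : Matrix (Fin N) (Fin N) ℝ) (i j : Fin N) : B i j ≤ bMax B :=
  (le_abs_self _).trans <|
    le_ciSup (f := fun p : Fin N × Fin N => |B p.1 p.2|) (Set.finite_range _).bddAbove (i, j)

theorem lt_bMin [NeZero N] {c : ℝ} (h : ∀ i j, c < B i j) : c < bMin B := by
  obtain ⟨p, hp⟩ := exists_eq_ciInf_of_finite (f := fun p : Fin N × Fin N => B p.1 p.2)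
  exact (h _ _).trans_eq hp

theorem bMax_lt [NeZero N] {c : ℝ} (h : ∀ i j, |B i j| < c) : bMax B < c := by
  obtain ⟨p, hp⟩ := exists_eq_ciSup_of_finite (f := fun p : Fin N × Fin N => |B p.1 p.2|)
  exact hp.symm.trans_lt (h _ _)

theorem bMin_le_bMax [NeZero N] : bMin B ≤ bMax B :=
  (bMin_le B 0 0).trans (le_bMax B 0 0)

theorem isHermitian_of_mem_matrixSpace (hB : B ∈ matrixSpace N) : B.IsHermitian := by
  rw [Matrix.IsHermitian, Matrix.conjTranspose_eq_transpose_of_trivial]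
  exact hB.2.1

theorem bMin_pos [NeZero N] (hB : B ∈ matrixSpace N) : 0 < bMin B := lt_bMin hB.1

theorem bMax_pos [NeZero N] (hB : B ∈ matrixSpace N) : 0 < bMax B :=
  (bMin_pos hB).trans_le bMin_le_bMax

open scoped Pointwise in
theorem posSemidef_one_sub (hB : B ∈ matrixSpace N) : (1 - B).PosSemidef := by
  have hH : (1 - B).IsHermitian := Matrix.isHermitian_one.sub (isHermitian_of_mem_matrixSpace hB)
  rw [hH.posSemidef_iff_eigenvalues_nonneg]
  intro i
  have hspec : spectrum ℝ (1 - B) = ({1} : Set ℝ) - spectrum ℝ B := by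
    rw [spectrum.singleton_sub_eq, map_one]
  have h := hH.eigenvalues_mem_spectrum_real i
  rw [hspec, Set.singleton_sub] at h
  obtain ⟨l, hl, h⟩ := h
  exact (sub_nonneg.2 (hB.2.2 l hl).2.le).trans_eq h

theorem sum_entries_le (hB : B ∈ matrixSpace N) : ∑ i, ∑ j, B i j ≤ N := by
  have h := (posSemidef_one_sub hB).dotProduct_mulVec_nonneg 1
  rw [Matrix.sub_mulVec, Matrix.one_mulVec, dotProduct_sub] at h
  simpa [Matrix.mulVec, dotProduct] using h

theorem bMin_mul_sum_entries_le_one [NeZero N] (hB : B ∈ matrixSpace N) :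
    bMin B * ∑ i, ∑ j, B i j ≤ 1 := by
  have hN : (0 : ℝ) < N := by exact_mod_cast NeZero.pos N
  have hsum : (N : ℝ) * (N * bMin B) ≤ ∑ i, ∑ j, B i j := by
    simpa using sum_le_sum fun i (_ : i ∈ univ) => sum_le_sum fun j (_ : j ∈ univ) => bMin_le B i j
  have hS := sum_entries_le hB
  have hNb : bMin B * N ≤ 1 := by
    rw [mul_comm]
    exact le_of_mul_le_mul_left (by linarith) hN
  exact (mul_le_mul_of_nonneg_left hS (bMin_pos hB).le).trans hNb

theorem hafRep_le {b : ℝ} {k : ℕ} (h0 : ∀ i j, 0 ≤ B i j) (hb : ∀ i j, B i j ≤ b)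
    {I : Fin N → ℕ} (hI : ∑ i, I i = 2 * k) : hafRep B I ≤ b ^ k * (2 * k - 1)‼ :=
  hafnian_le_of_le (hI.trans (mul_comm _ _)) (fun _ _ => h0 _ _) fun _ _ => hb _ _

theorem le_hafRep {b : ℝ} {k : ℕ} (h0 : 0 ≤ b) (hb : ∀ i j, b ≤ B i j)
    {I : Fin N → ℕ} (hI : ∑ i, I i = 2 * k) : b ^ k * (2 * k - 1)‼ ≤ hafRep B I :=
  le_hafnian_of_le (hI.trans (mul_comm _ _)) h0 fun _ _ => hb _ _

theorem hafRep_pos [NeZero N] (hB : B ∈ matrixSpace N) (I : Idx N k) : 0 < hafRep B I.1 :=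
  (mul_pos (pow_pos (bMin_pos hB) _) (by exact_mod_cast Nat.doubleFactorial_pos _)).trans_le
    (le_hafRep (bMin_pos hB).le (bMin_le B) I.2)

theorem hafRep_le_multiFactorial_div [NeZero N] (hB : B ∈ matrixSpace N) (I : Idx N k) :
    hafRep B I.1 ≤ multiFactorial I.1 / (bMin B ^ k * (2 * k - 1)‼) := by
  have hb := bMin_pos hB
  have hS : 0 ≤ ∑ i, ∑ j, B i j := sum_nonneg fun i _ => sum_nonneg fun j _ => (hB.1 i j).le
  have hI := multiFactorial_pos I.1
  refine (hafRep_le_multiFactorial_mul (fun i j => (hB.1 i j).le) I).trans ?_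
  rw [div_le_div_iff₀ (by positivity)
    (mul_pos (by positivity) (by exact_mod_cast Nat.doubleFactorial_pos _))]
  calc multiFactorial I.1 * (∑ i, ∑ j, B i j) ^ k * (bMin B ^ k * (2 * k - 1)‼)
      = multiFactorial I.1 * ((bMin B * ∑ i, ∑ j, B i j) ^ k * (2 * k - 1)‼) := by ring
    _ ≤ multiFactorial I.1 * (1 ^ k * (2 ^ k * k !)) := by
        gcongr
        exacts [bMin_mul_sum_entries_le_one hB, doubleFactorial_le k]
    _ = multiFactorial I.1 * (k ! * 2 ^ k) := by ring

theorem multiFactorial_div_hafRep_le [NeZero N] (hB : B ∈ matrixSpace N) (I : Idx N k) :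
    multiFactorial I.1 / hafRep B I.1 ≤ multiFactorial I.1 / (bMin B ^ k * (2 * k - 1)‼) :=
  div_le_div_of_nonneg_left (multiFactorial_pos I.1).le
    (mul_pos (pow_pos (bMin_pos hB) _) (by exact_mod_cast Nat.doubleFactorial_pos _))
    (le_hafRep (bMin_pos hB).le (bMin_le B) I.2)

theorem dConst_eq_prod_eigenvalues (hB : B.IsHermitian) :
    dConst B = ∏ i, √(1 - hB.eigenvalues i ^ 2) := by
  rw [dConst, hB.roots_charpoly_eq_eigenvalues, Multiset.map_map, prod_eq_multiset_prod]
  rfl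

theorem dConst_pos (hB : B ∈ matrixSpace N) : 0 < dConst B := by
  have hH := isHermitian_of_mem_matrixSpace hB
  rw [dConst_eq_prod_eigenvalues hH]
  refine prod_pos fun i _ => Real.sqrt_pos.2 ?_
  obtain ⟨h0, h1⟩ := hB.2.2 _ (hH.eigenvalues_mem_spectrum_real i)
  nlinarith

theorem dConst_le_one (hB : B.IsHermitian) : dConst B ≤ 1 := by
  rw [dConst_eq_prod_eigenvalues hB]
  exact prod_le_one (fun _ _ => Real.sqrt_nonneg _) fun i _ =>
    Real.sqrt_le_one.2 (sub_le_self _ (sq_nonneg _))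

theorem abs_le_of_mem_spectrum {c l : ℝ} (hc : ∀ i j, |B i j| ≤ c) (hl : l ∈ spectrum ℝ B) :
    |l| ≤ N * c := by
  have h : Module.End.HasEigenvalue (Matrix.toLin' B) l := by
    rwa [Module.End.hasEigenvalue_iff_mem_spectrum, Matrix.spectrum_toLin']
  obtain ⟨i, hi⟩ := eigenvalue_mem_ball h
  rw [mem_closedBall_iff_norm] at hi
  calc |l| = ‖l - B i i + B i i‖ := by rw [sub_add_cancel, Real.norm_eq_abs]
    _ ≤ ∑ j ∈ univ.erase i, ‖B i j‖ + ‖B i i‖ := (norm_add_le _ _).trans (by gcongr)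
    _ = ∑ j, ‖B i j‖ := sum_erase_add _ _ (mem_univ i)
    _ ≤ ∑ _j : Fin N, c := sum_le_sum fun _ _ => hc i _
    _ = N * c := by simp

theorem sqrt_pow_le_dConst {c : ℝ} (hB : B.IsHermitian) (hc : ∀ i j, |B i j| ≤ c) :
    √(1 - (N * c) ^ 2) ^ N ≤ dConst B := by
  rw [dConst_eq_prod_eigenvalues hB]
  calc √(1 - (N * c) ^ 2) ^ N = ∏ _i : Fin N, √(1 - (N * c) ^ 2) := by simp
    _ ≤ ∏ i, √(1 - hB.eigenvalues i ^ 2) := by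
        refine prod_le_prod (fun _ _ => Real.sqrt_nonneg _) fun i _ =>
          Real.sqrt_le_sqrt (sub_le_sub_left ?_ 1)
        have h := abs_le_of_mem_spectrum hc (hB.eigenvalues_mem_spectrum_real i)
        exact sq_le_sq' (neg_le_of_abs_le h) (le_of_abs_le h)

end Matrices

section Polylog

variable {s z : ℝ} {K : ℕ∞}

/-- The summand `z^k / k^s`, `1 ≤ k ≤ K`, of the truncated polylogarithm, extended by zero. -/
def polylogTerm (s : ℝ) (K : ℕ∞) (z : ℝ) (k : ℕ) : ℝ :=
  if 1 ≤ k ∧ (k : ℕ∞) ≤ K then z ^ k / (k : ℝ) ^ s else 0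

theorem polylog_eq_tsum (s : ℝ) (K : ℕ∞) (z : ℝ) : polylog s K z = ∑' k, polylogTerm s K z k := by
  unfold polylog polylogTerm
  refine tsum_congr fun k => ?_
  congr

theorem polylogTerm_of_le {k : ℕ} (h1 : 1 ≤ k) (hK : (k : ℕ∞) ≤ K) :
    polylogTerm s K z k = z ^ k / (k : ℝ) ^ s := if_pos ⟨h1, hK⟩

theorem polylogTerm_nonneg (s : ℝ) (K : ℕ∞) (hz : 0 ≤ z) (k : ℕ) : 0 ≤ polylogTerm s K z k := by
  unfold polylogTerm
  split_ifs
  · positivity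
  · exact le_rfl

theorem summable_polylogTerm_top (hz : 0 ≤ z) (h : z < 1) : Summable (polylogTerm s ⊤ z) := by
  have hs := summable_pow_mul_geometric_of_norm_lt_one (R := ℝ) ⌈|s|⌉₊ (r := z)
    (by rwa [Real.norm_eq_abs, abs_of_nonneg hz])
  refine hs.of_nonneg_of_le (polylogTerm_nonneg s ⊤ hz) fun k => ?_
  unfold polylogTerm
  split_ifs with hk
  · have hk1 : (1 : ℝ) ≤ k := by exact_mod_cast hk.1
    rw [div_eq_inv_mul, ← Real.rpow_neg (by positivity), ← Real.rpow_natCast (k : ℝ) ⌈|s|⌉₊]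
    gcongr
    exact (neg_le_abs s).trans (Nat.le_ceil _)
  · positivity

theorem summable_polylogTerm (hz : 0 ≤ z) (h : K = ⊤ → z < 1) : Summable (polylogTerm s K z) := by
  induction K using ENat.recTopCoe with
  | top => exact summable_polylogTerm_top hz (h rfl)
  | coe n =>
    refine summable_of_ne_finset_zero (s := range (n + 1)) fun k hk => if_neg ?_
    rintro ⟨-, hkn⟩
    exact hk (mem_range.2 (Nat.lt_succ_of_le (Nat.cast_le.1 hkn)))

theorem hasSum_polylogTerm (hz : 0 ≤ z) (h : K = ⊤ → z < 1) :
    HasSum (polylogTerm s K z) (polylog s K z) := by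
  rw [polylog_eq_tsum]
  exact (summable_polylogTerm hz h).hasSum

theorem polylog_nonneg (s : ℝ) (K : ℕ∞) (hz : 0 ≤ z) : 0 ≤ polylog s K z := by
  rw [polylog_eq_tsum]
  exact tsum_nonneg (polylogTerm_nonneg s K hz)

theorem polylog_mono {K' : ℕ∞} {z' : ℝ} (hK : K ≤ K') (hz : 0 ≤ z) (hzz : z ≤ z')
    (h : K' = ⊤ → z' < 1) : polylog s K z ≤ polylog s K' z' := by
  have hz' := hz.trans hzz
  have hle : ∀ k, polylogTerm s K z k ≤ polylogTerm s K' z' k := fun k => by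
    by_cases hk : 1 ≤ k ∧ (k : ℕ∞) ≤ K
    · rw [polylogTerm_of_le hk.1 hk.2, polylogTerm_of_le hk.1 (hk.2.trans hK)]
      gcongr
    · rw [polylogTerm, if_neg hk]
      exact polylogTerm_nonneg _ _ hz' _
  have hs := summable_polylogTerm (s := s) hz' h
  rw [polylog_eq_tsum, polylog_eq_tsum]
  exact (hs.of_nonneg_of_le (polylogTerm_nonneg _ _ hz) hle).tsum_le_tsum hle hs

theorem hasSum_one_add_polylog (c : ℝ) (hz : 0 ≤ z) (h : K = ⊤ → z < 1) :
    HasSum (fun k : Level K => if k.1 = 0 then 1 else c * (z ^ k.1 / (k.1 : ℝ) ^ s))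
      (1 + c * polylog s K z) := by
  have hnat : HasSum (fun k : ℕ => (if k = 0 then 1 else 0) + c * polylogTerm s K z k)
      (1 + c * polylog s K z) :=
    (hasSum_ite_eq _ _).add ((hasSum_polylogTerm hz h).mul_left c)
  refine (hasSum_subtype_iff_indicator
    (f := fun k : ℕ => if k = 0 then 1 else c * (z ^ k / (k : ℝ) ^ s))
    (s := {k : ℕ | (k : ℕ∞) ≤ K})).2 ?_
  convert hnat using 1
  funext k
  by_cases hk0 : k = 0
  · simp [hk0, polylogTerm]
  · by_cases hk : (k : ℕ∞) ≤ K
    · simp [hk0, hk, polylogTerm_of_le (Nat.one_le_iff_ne_zero.2 hk0) hk]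
    · simp [hk0, hk, polylogTerm]

end Polylog

section ComparisonG

variable {K : ℕ∞} {N k : ℕ} {q z : ℝ}

theorem two_mul_eq_mul_sIdx_add_rIdx : 2 * k = N * sIdx N k + rIdx N k := by
  have := Nat.mul_div_le (2 * k - 1) N
  unfold rIdx sIdx
  omega

theorem one_le_rIdx (hk : 1 ≤ k) : 1 ≤ rIdx N k := by
  have := Nat.mul_div_le (2 * k - 1) N
  unfold rIdx sIdx
  omega

theorem rIdx_le [NeZero N] : rIdx N k ≤ N := by
  have := Nat.lt_mul_div_succ (2 * k - 1) (NeZero.pos N)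
  rw [Nat.mul_succ] at this
  unfold rIdx sIdx
  omega

theorem sIdx_mono (N : ℕ) : Monotone (sIdx N) := fun _ _ _ =>
  Nat.div_le_div_right (by omega)

theorem sIdx_le_sTop (hk : (k : ℕ∞) ≤ K) : (sIdx N k : ℕ∞) ≤ sTop N K := by
  unfold sTop
  induction K using ENat.recTopCoe with
  | top => exact le_top
  | coe n =>
    rw [ENat.map_natCast]
    exact Nat.cast_le.2 (sIdx_mono N (Nat.cast_le.1 hk))

theorem eq_top_of_sTop_eq_top (h : sTop N K = ⊤) : K = ⊤ := by
  induction K using ENat.recTopCoe with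
  | top => rfl
  | coe n => exact absurd h (ENat.natCast_ne_top _)

/-- The level `k` is determined by the pair `(r_k, s_k)`. -/
def levelEmbedding (N : ℕ) (K : ℕ∞) : Level K ↪ ℕ × ℕ where
  toFun k := (rIdx N k.1, sIdx N k.1)
  inj' a b hab := by
    have ha := two_mul_eq_mul_sIdx_add_rIdx (N := N) (k := a.1)
    have hb := two_mul_eq_mul_sIdx_add_rIdx (N := N) (k := b.1)
    simp only [Prod.mk.injEq] at hab
    rw [hab.1, hab.2] at ha
    exact Subtype.ext (by omega)

/-- `k^q`, with the value `1` at `k = 0`. -/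
def powWeight (q : ℝ) (k : ℕ) : ℝ := if k = 0 then 1 else (k : ℝ) ^ q

theorem powWeight_pos (q : ℝ) (k : ℕ) : 0 < powWeight q k := by
  unfold powWeight
  split_ifs with h
  · exact one_pos
  · have := Nat.pos_of_ne_zero h
    positivity

theorem powWeight_of_one_le (hk : 1 ≤ k) : powWeight q k = (k : ℝ) ^ q :=
  if_neg (Nat.one_le_iff_ne_zero.1 hk)

/-- The summand `k^q m_k z^{2k} / (2k)!` of the series that `1 + G` dominates. -/
def gSeries (N : ℕ) (q z : ℝ) (k : ℕ) : ℝ :=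
  powWeight q k * mIdx N k * z ^ (2 * k) / ((2 * k)! : ℝ)

theorem mIdx_pos : 0 < mIdx N k := by
  unfold mIdx
  positivity

theorem gSeries_nonneg (hz : 0 ≤ z) : 0 ≤ gSeries N q z k := by
  have := powWeight_pos q k
  have := mIdx_pos (N := N) (k := k)
  unfold gSeries
  positivity

theorem mIdx_of_two_mul_le [NeZero N] (hk : 2 * k ≤ N) : mIdx N k = 1 := by
  have hs : sIdx N k = 0 := Nat.div_eq_of_lt (by have := NeZero.pos N; omega)
  simp [mIdx, hs]

theorem sum_range_gSeries [NeZero N] :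
    ∑ k ∈ range (N / 2 + 1), gSeries N q z k = 1 + hFun q (N / 2) z := by
  rw [range_eq_Ico, sum_eq_sum_Ico_succ_bot (Nat.succ_pos _)]
  congr 1
  · simp [gSeries, powWeight, mIdx_of_two_mul_le]
  · refine sum_congr (by ext; simp) fun k hk => ?_
    obtain ⟨hk1, hk2⟩ := mem_Ico.1 hk
    rw [gSeries, powWeight_of_one_le (by omega), mIdx_of_two_mul_le (by omega)]
    ring

/-- The constant in front of the product of polylogarithms in the definition of `G`. -/
def gConst (q : ℝ) (N : ℕ) : ℝ :=
  (2 : ℝ) ^ (-min q 0) * (2 * Real.pi) ^ (((N : ℝ) - 1) / 2) * (N : ℝ) ^ (q - 1 / 2) *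
    Real.exp ((N : ℝ) / 12)

theorem gConst_nonneg (q : ℝ) (N : ℕ) : 0 ≤ gConst q N := by
  have := Real.pi_pos
  unfold gConst
  positivity

/-- The summands of the product of polylogarithms in the definition of `G`, indexed by `(r, s)`. -/
def gTail (q : ℝ) (K : ℕ∞) (N : ℕ) (z : ℝ) (p : ℕ × ℕ) : ℝ :=
  polylogTerm 0 N (2 * z / N) p.1 *
    polylogTerm (1 / 2 - (N : ℝ) / 2 - q) (sTop N K) (z ^ N / (N : ℝ) ^ N) p.2

theorem gTail_nonneg (hz : 0 ≤ z) (p : ℕ × ℕ) : 0 ≤ gTail q K N z p :=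
  mul_nonneg (polylogTerm_nonneg _ _ (by positivity) _) (polylogTerm_nonneg _ _ (by positivity) _)

theorem pow_div_pow_lt_one [NeZero N] (hz : 0 ≤ z) (h : z < N) : z ^ N / (N : ℝ) ^ N < 1 := by
  have hN : (0 : ℝ) < N := by exact_mod_cast NeZero.pos N
  rw [← div_pow]
  exact pow_lt_one₀ (by positivity) ((div_lt_one hN).2 h) (NeZero.ne N)

theorem hasSum_gTail [NeZero N] (hz : 0 ≤ z) (h : K = ⊤ → z < N) :
    HasSum (gTail q K N z) (polylog 0 N (2 * z / N) *
      polylog (1 / 2 - (N : ℝ) / 2 - q) (sTop N K) (z ^ N / (N : ℝ) ^ N)) := by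
  have hr := hasSum_polylogTerm (s := 0) (K := N) (z := 2 * z / N) (by positivity)
    fun h => absurd h (ENat.natCast_ne_top _)
  have hs := hasSum_polylogTerm (s := 1 / 2 - (N : ℝ) / 2 - q) (K := sTop N K)
    (z := z ^ N / (N : ℝ) ^ N) (by positivity)
    fun hK => pow_div_pow_lt_one hz (h (eq_top_of_sTop_eq_top hK))
  exact hr.mul hs <| hr.summable.mul_of_nonneg hs.summable
    (polylogTerm_nonneg _ _ (by positivity)) (polylogTerm_nonneg _ _ (by positivity))

theorem rpow_le_two_rpow_mul_rpow {x y : ℝ} (hy : 0 < y) (h1 : y / 2 ≤ x) (h2 : x ≤ y) :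
    x ^ q ≤ (2 : ℝ) ^ (-min q 0) * y ^ q := by
  rcases le_total 0 q with hq | hq
  · rw [min_eq_right hq, neg_zero, Real.rpow_zero, one_mul]
    exact Real.rpow_le_rpow (by linarith) h2 hq
  · rw [min_eq_left hq, Real.rpow_neg zero_le_two, inv_mul_eq_div,
      ← Real.div_rpow hy.le zero_le_two]
    exact Real.rpow_le_rpow_of_nonpos (by linarith) h1 hq

theorem sqrt_pow_div_sqrt_eq [NeZero N] {s : ℝ} (hs : 0 < s) :
    √(2 * Real.pi * s) ^ N / √(2 * Real.pi * (N * s)) =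
      (2 * Real.pi) ^ (((N : ℝ) - 1) / 2) * (N : ℝ) ^ (-(1 / 2) : ℝ) *
        s ^ (((N : ℝ) - 1) / 2) := by
  have hN : (0 : ℝ) < N := by exact_mod_cast NeZero.pos N
  have := Real.pi_pos
  have hden : √(2 * Real.pi * (N * s)) = √(2 * Real.pi * s) * √N := by
    rw [← Real.sqrt_mul (by positivity)]
    ring_nf
  have hnum : √(2 * Real.pi * s) ^ N =
      √(2 * Real.pi * s) * (2 * Real.pi * s) ^ (((N : ℝ) - 1) / 2) := by
    rw [Real.sqrt_eq_rpow, ← Real.rpow_natCast, ← Real.rpow_mul (by positivity),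
      ← Real.rpow_add (by positivity)]
    ring_nf
  rw [hden, hnum, Real.mul_rpow (by positivity) hs.le, Real.rpow_neg hN.le, ← Real.sqrt_eq_rpow]
  field_simp

theorem le_factorial_mul_add (N s r : ℕ) :
    √(2 * Real.pi * (N * s)) * (N * s / Real.exp 1) ^ (N * s) * (N * s : ℝ) ^ r ≤
      ((N * s + r)! : ℝ) := by
  have hst := Stirling.le_factorial_stirling (N * s)
  push_cast at hst
  calc _ ≤ ((N * s)! : ℝ) * ((N * s : ℝ) + 1) ^ r := by gcongr; linarith
    _ ≤ ((N * s + r)! : ℝ) := by exact_mod_cast Nat.factorial_mul_pow_le_factorial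

theorem factorial_pow_div_factorial_le [NeZero N] {s : ℕ} (hs : 1 ≤ s) (r : ℕ) :
    (s ! : ℝ) ^ N * ((s : ℝ) + 1) ^ r / ((N * s + r)! : ℝ) ≤
      (2 * Real.pi) ^ (((N : ℝ) - 1) / 2) * (N : ℝ) ^ (-(1 / 2) : ℝ) * Real.exp ((N : ℝ) / 12) *
        (s : ℝ) ^ (((N : ℝ) - 1) / 2) * (2 / N) ^ r * ((1 / (N : ℝ) ^ N) ^ s) := by
  have hs1 : (1 : ℝ) ≤ s := by exact_mod_cast hs
  have hs0 : (0 : ℝ) < s := by linarith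
  have hN : (0 : ℝ) < N := by exact_mod_cast NeZero.pos N
  have := Real.pi_pos
  have hsucc : (s : ℝ) + 1 ≤ 2 * s := by linarith
  calc (s ! : ℝ) ^ N * ((s : ℝ) + 1) ^ r / ((N * s + r)! : ℝ)
      ≤ (√(2 * Real.pi * s) * (s / Real.exp 1) ^ s * Real.exp (1 / 12)) ^ N * (2 * s) ^ r /
        (√(2 * Real.pi * (N * s)) * (N * s / Real.exp 1) ^ (N * s) * (N * s : ℝ) ^ r) := by
          gcongr
          exacts [factorial_le_stirling hs, le_factorial_mul_add N s r]
    _ = √(2 * Real.pi * s) ^ N / √(2 * Real.pi * (N * s)) * Real.exp ((N : ℝ) / 12) *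
          (2 / N) ^ r * ((1 / (N : ℝ) ^ N) ^ s) := by
        have hexp : Real.exp ((N : ℝ) / 12) = Real.exp (1 / 12) ^ N := by
          rw [← Real.exp_nat_mul]
          ring_nf
        simp only [hexp, mul_pow, div_pow, one_pow, ← pow_mul, mul_comm s N]
        field_simp
    _ = _ := by
        rw [sqrt_pow_div_sqrt_eq hs0]
        ring

theorem rpow_le_of_lt_two_mul [NeZero N] (q : ℝ) (hk : N < 2 * k) :
    (k : ℝ) ^ q ≤ (2 : ℝ) ^ (-min q 0) * ((N : ℝ) ^ q * (sIdx N k : ℝ) ^ q) := by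
  have hs : 1 ≤ sIdx N k := (Nat.one_le_div_iff (NeZero.pos N)).2 (by omega)
  have hs0 : (0 : ℝ) < sIdx N k := by exact_mod_cast hs
  have hN : (0 : ℝ) < N := by exact_mod_cast NeZero.pos N
  -- `N s ≤ 2k = N s + r ≤ 2 N s`, since `r ≤ N` and `1 ≤ s`.
  have hr : (rIdx N k : ℝ) ≤ N * sIdx N k := by
    exact_mod_cast rIdx_le.trans (Nat.le_mul_of_pos_right N hs)
  have h2k : (2 * k : ℝ) = N * sIdx N k + rIdx N k := by
    exact_mod_cast two_mul_eq_mul_sIdx_add_rIdx (N := N) (k := k)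
  have : (0 : ℝ) ≤ rIdx N k := Nat.cast_nonneg _
  rw [← Real.mul_rpow hN.le hs0.le]
  refine rpow_le_two_rpow_mul_rpow (by positivity) ?_ ?_ <;> linarith

theorem gSeries_le_gTail [NeZero N] (hk : N < 2 * k) (hkK : (k : ℕ∞) ≤ K) (hz : 0 ≤ z) :
    gSeries N q z k ≤ gConst q N * gTail q K N z (rIdx N k, sIdx N k) := by
  have hN : (0 : ℝ) < N := by exact_mod_cast NeZero.pos N
  have hr1 : 1 ≤ rIdx N k := one_le_rIdx (by omega)
  have hrN : rIdx N k ≤ N := rIdx_le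
  have hs1 : 1 ≤ sIdx N k := (Nat.one_le_div_iff (NeZero.pos N)).2 (by omega)
  have h2k := two_mul_eq_mul_sIdx_add_rIdx (N := N) (k := k)
  rw [gTail, polylogTerm_of_le hr1 (by exact_mod_cast hrN),
    polylogTerm_of_le hs1 (sIdx_le_sTop hkK), gSeries, mIdx, powWeight_of_one_le (by omega)]
  set s := sIdx N k
  set r := rIdx N k
  have hs0 : (0 : ℝ) < s := by exact_mod_cast hs1
  have hkq := rpow_le_of_lt_two_mul q hk
  have hfac := factorial_pow_div_factorial_le (N := N) hs1 r
  rw [← h2k] at hfac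
  have := Real.pi_pos
  have hNq : (N : ℝ) ^ (q - 1 / 2) = (N : ℝ) ^ q * (N : ℝ) ^ (-(1 / 2) : ℝ) := by
    rw [← Real.rpow_add hN, sub_eq_add_neg]
  have hsq : ((s : ℝ) ^ (1 / 2 - (N : ℝ) / 2 - q))⁻¹ =
      (s : ℝ) ^ q * (s : ℝ) ^ (((N : ℝ) - 1) / 2) := by
    rw [← Real.rpow_neg hs0.le, ← Real.rpow_add hs0]
    ring_nf
  have hz2k : z ^ (2 * k) = (z ^ N) ^ s * z ^ r := by rw [h2k, pow_add, pow_mul]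
  calc (k : ℝ) ^ q * ((s ! : ℝ) ^ N * ((s : ℝ) + 1) ^ r) * z ^ (2 * k) / ((2 * k)! : ℝ)
      = (k : ℝ) ^ q * ((s ! : ℝ) ^ N * ((s : ℝ) + 1) ^ r / ((2 * k)! : ℝ)) * z ^ (2 * k) := by
        ring
    _ ≤ ((2 : ℝ) ^ (-min q 0) * ((N : ℝ) ^ q * (s : ℝ) ^ q)) * ((2 * Real.pi) ^
          (((N : ℝ) - 1) / 2) * (N : ℝ) ^ (-(1 / 2) : ℝ) * Real.exp ((N : ℝ) / 12) *
          (s : ℝ) ^ (((N : ℝ) - 1) / 2) * (2 / N) ^ r * ((1 / (N : ℝ) ^ N) ^ s)) *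
          z ^ (2 * k) := by gcongr
    _ = _ := by
        rw [gConst, hNq, div_eq_mul_inv (_ ^ s), hsq, hz2k, Real.rpow_zero, div_one,
          mul_div_right_comm, mul_pow, div_eq_mul_one_div (z ^ N), mul_pow]
        ring

theorem gFun_eq (q : ℝ) (K : ℕ∞) (N : ℕ) (z : ℝ) :
    gFun q K N z = hFun q (N / 2) z + gConst q N * polylog 0 N (2 * z / N) *
      polylog (1 / 2 - (N : ℝ) / 2 - q) (sTop N K) (z ^ N / (N : ℝ) ^ N) := rfl

theorem gFun_nonneg (hz : 0 ≤ z) : 0 ≤ gFun q K N z := by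
  rw [gFun_eq]
  refine add_nonneg (sum_nonneg fun k _ => by positivity) (mul_nonneg (mul_nonneg
    (gConst_nonneg _ _) (polylog_nonneg _ _ ?_)) (polylog_nonneg _ _ ?_)) <;> positivity

theorem sum_gSeries_le [NeZero N] (hz : 0 ≤ z) (h : K = ⊤ → z < N) (S : Finset (Level K)) :
    ∑ k ∈ S, gSeries N q z k.1 ≤ 1 + gFun q K N z := by
  rw [← sum_filter_add_sum_filter_not S (fun k => 2 * k.1 ≤ N), gFun_eq, ← add_assoc, mul_assoc]
  gcongr ?_ + ?_
  · rw [← sum_range_gSeries]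
    refine (sum_map _ (Function.Embedding.subtype _) (gSeries N q z)).symm.trans_le <|
      sum_le_sum_of_subset_of_nonneg (fun k hk => ?_) fun _ _ _ => gSeries_nonneg hz
    obtain ⟨l, hl, rfl⟩ := mem_map.1 hk
    have := (mem_filter.1 hl).2
    exact mem_range.2 (by rw [Function.Embedding.subtype_apply]; omega)
  · calc _ ≤ ∑ k ∈ S with ¬ 2 * k.1 ≤ N, gConst q N * gTail q K N z (levelEmbedding N K k) :=
          sum_le_sum fun k hk => gSeries_le_gTail (not_le.1 (mem_filter.1 hk).2) k.2 hz
      _ ≤ _ := by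
          rw [← mul_sum, ← sum_map _ (levelEmbedding N K) (gTail q K N z)]
          exact mul_le_mul_of_nonneg_left
            (sum_le_hasSum _ (fun p _ => gTail_nonneg hz p) (hasSum_gTail hz h)) (gConst_nonneg _ _)

theorem gFun_mono [NeZero N] {z' : ℝ} (hz : 0 ≤ z) (hzz : z ≤ z') (hz' : z' < N) :
    gFun q K N z ≤ gFun q ⊤ N z' := by
  have hz0 := hz.trans hzz
  rw [gFun_eq, gFun_eq]
  gcongr ?_ + _ * ?_ * ?_
  · unfold hFun
    gcongr
  · exact polylog_nonneg _ _ (by positivity)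
  · exact mul_nonneg (gConst_nonneg _ _) (polylog_nonneg _ _ (by positivity))
  · exact gConst_nonneg _ _
  · exact polylog_mono le_rfl (by positivity) (by gcongr) fun h => absurd h (ENat.natCast_ne_top _)
  · exact polylog_mono le_top (by positivity) (by gcongr) fun _ => pow_div_pow_lt_one hz0 hz'

end ComparisonG

section LevelWeight

variable {q γ : ℝ} {k : ℕ}

/-- The weight `k^q γ^k / k!` in the conditions on the coefficients, extended by `1` to `k = 0`. -/
def levelWeight (q γ : ℝ) (k : ℕ) : ℝ := powWeight q k * γ ^ k / (k ! : ℝ)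

theorem levelWeight_zero : levelWeight q γ 0 = 1 := by simp [levelWeight, powWeight]

theorem levelWeight_of_one_le (hk : 1 ≤ k) :
    levelWeight q γ k = (k : ℝ) ^ q * γ ^ k / (k ! : ℝ) := by
  rw [levelWeight, powWeight_of_one_le hk]

theorem levelWeight_nonneg (hγ : 0 ≤ γ) (k : ℕ) : 0 ≤ levelWeight q γ k := by
  have := powWeight_pos q k
  unfold levelWeight
  positivity

end LevelWeight

section Terms

variable {N : ℕ} {K : ℕ∞} {B : Matrix (Fin N) (Fin N) ℝ} {a : Coeff N K} {q γ M : ℝ}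

theorem sum_coeff_mul_zero (a : Coeff N K) (f : (Fin N → ℕ) → ℝ) (h : ((0 : ℕ) : ℕ∞) ≤ K) :
    ∑ I, a ⟨0, h⟩ I * f I.1 = coeffZero a * f 0 := by
  refine Fintype.sum_eq_single (⟨0, by simp⟩ : Idx N 0) fun I hI => (hI (Subtype.ext ?_)).elim
  funext i
  exact sum_eq_zero_iff.1 (by simpa using I.2) i (mem_univ i)

theorem sum_coeff_zero (a : Coeff N K) (h : ((0 : ℕ) : ℕ∞) ≤ K) :
    ∑ I, a ⟨0, h⟩ I = coeffZero a := by
  simpa using sum_coeff_mul_zero a (fun _ => 1) h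

theorem sum_coeff_nonneg (ha : Nonneg a) (k : Level K) : 0 ≤ ∑ I, a k I :=
  sum_nonneg fun I _ => ha k I

theorem muTerm_nonneg [NeZero N] (hB : B ∈ matrixSpace N) (ha : Nonneg a) (k : Level K) :
    0 ≤ muTerm a B k :=
  sum_nonneg fun I _ => mul_nonneg (ha k I) (hafRep_pos hB I).le

theorem muTerm_le {b : ℝ} (h0 : ∀ i j, 0 ≤ B i j) (hb : ∀ i j, B i j ≤ b) (ha : Nonneg a)
    (k : Level K) : muTerm a B k ≤ (∑ I, a k I) * (b ^ k.1 * (2 * k.1 - 1)‼) := by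
  rw [muTerm, sum_mul]
  exact sum_le_sum fun I _ => mul_le_mul_of_nonneg_left (hafRep_le h0 hb I.2) (ha k I)

theorem le_muTerm {b : ℝ} (h0 : 0 ≤ b) (hb : ∀ i j, b ≤ B i j) (ha : Nonneg a)
    (k : Level K) : (∑ I, a k I) * (b ^ k.1 * (2 * k.1 - 1)‼) ≤ muTerm a B k := by
  rw [muTerm, sum_mul]
  exact sum_le_sum fun I _ => mul_le_mul_of_nonneg_left (le_hafRep h0 hb I.2) (ha k I)

/-- The sums `∑_{|J|=2k} a_J J! / Haf(B_J)`, which carry the second summation index of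
`Q^{GBS-P}`. -/
def invTerm (a : Coeff N K) (B : Matrix (Fin N) (Fin N) ℝ) (k : Level K) : ℝ :=
  ∑ J, a k J * (multiFactorial J.1 / hafRep B J.1)

theorem gbspTerm_eq (a : Coeff N K) (B : Matrix (Fin N) (Fin N) ℝ) (p : Level K × Level K) :
    gbspTerm a B p = muTerm a B p.1 * invTerm a B p.2 := by
  rw [gbspTerm, muTerm, invTerm, sum_mul_sum]
  exact sum_congr rfl fun I _ => sum_congr rfl fun J _ => by ring

theorem invTerm_nonneg [NeZero N] (hB : B ∈ matrixSpace N) (ha : Nonneg a) (k : Level K) :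
    0 ≤ invTerm a B k :=
  sum_nonneg fun I _ =>
    mul_nonneg (ha k I) (div_nonneg (multiFactorial_pos _).le (hafRep_pos hB I).le)

theorem sum_coeff_mul_le_gSeries [NeZero N] (hB : B ∈ matrixSpace N) (ha : Nonneg a) (hγ : 0 ≤ γ)
    {k : Level K} {f : (Fin N → ℕ) → ℝ}
    (hf : ∀ I : Idx N k.1, f I.1 ≤ multiFactorial I.1 / (bMin B ^ k.1 * (2 * k.1 - 1)‼))
    (hk : ∑ I, a k I * multiFactorial I.1 ≤ M * levelWeight q γ k.1 * mIdx N k.1) :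
    ∑ I, a k I * f I.1 ≤ M * gSeries N q (√(2 * γ * (bMin B)⁻¹)) k.1 := by
  have hb := bMin_pos hB
  have : (0 : ℝ) < (2 * k.1 - 1)‼ := by exact_mod_cast Nat.doubleFactorial_pos _
  calc ∑ I, a k I * f I.1
      ≤ ∑ I, a k I * (multiFactorial I.1 / (bMin B ^ k.1 * (2 * k.1 - 1)‼)) :=
        sum_le_sum fun I _ => mul_le_mul_of_nonneg_left (hf I) (ha k I)
    _ = (∑ I, a k I * multiFactorial I.1) / (bMin B ^ k.1 * (2 * k.1 - 1)‼) := by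
        rw [sum_div]
        exact sum_congr rfl fun I _ => (mul_div_assoc _ _ _).symm
    _ ≤ M * levelWeight q γ k.1 * mIdx N k.1 / (bMin B ^ k.1 * (2 * k.1 - 1)‼) := by gcongr
    _ = M * gSeries N q (√(2 * γ * (bMin B)⁻¹)) k.1 := by
        rw [gSeries, levelWeight, pow_mul, Real.sq_sqrt (by positivity), mul_pow, mul_pow, inv_pow,
          factorial_two_mul_eq_doubleFactorial_mul]
        push_cast
        field_simp

theorem sum_idx_add {k l : ℕ} (I : Idx N k) (J : Idx N l) :
    ∑ i, (I.1 + J.1) i = 2 * (k + l) := by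
  simp only [Pi.add_apply, sum_add_distrib, I.2, J.2]
  ring

theorem mcTerm_nonneg [NeZero N] (hB : B ∈ matrixSpace N) (ha : Nonneg a)
    (p : Level K × Level K) : 0 ≤ mcTerm a B p :=
  sum_nonneg fun I _ => sum_nonneg fun J _ => mul_nonneg (mul_nonneg (ha _ I) (ha _ J))
    (hafRep_pos (k := p.1.1 + p.2.1) hB ⟨I.1 + J.1, sum_idx_add I J⟩).le

theorem mcTerm_le {b : ℝ} (h0 : ∀ i j, 0 ≤ B i j) (hb : ∀ i j, B i j ≤ b) (ha : Nonneg a)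
    (p : Level K × Level K) : mcTerm a B p ≤ (∑ I, a p.1 I) * (∑ J, a p.2 J) *
      (b ^ (p.1.1 + p.2.1) * (2 * (p.1.1 + p.2.1) - 1)‼) := by
  rw [mcTerm, sum_mul_sum, sum_mul]
  refine sum_le_sum fun I _ => ?_
  rw [sum_mul]
  exact sum_le_sum fun J _ => mul_le_mul_of_nonneg_left
    (hafRep_le h0 hb (sum_idx_add I J)) (mul_nonneg (ha _ I) (ha _ J))

theorem le_mcTerm {b : ℝ} (h0 : 0 ≤ b) (hb : ∀ i j, b ≤ B i j) (ha : Nonneg a)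
    (p : Level K × Level K) : (∑ I, a p.1 I) * (∑ J, a p.2 J) *
      (b ^ (p.1.1 + p.2.1) * (2 * (p.1.1 + p.2.1) - 1)‼) ≤ mcTerm a B p := by
  rw [mcTerm, sum_mul_sum, sum_mul]
  refine sum_le_sum fun I _ => ?_
  rw [sum_mul]
  exact sum_le_sum fun J _ => mul_le_mul_of_nonneg_left
    (le_hafRep h0 hb (sum_idx_add I J)) (mul_nonneg (ha _ I) (ha _ J))

end Terms

section UpperBounds

variable {N : ℕ} [NeZero N] {K : ℕ∞} {B : Matrix (Fin N) (Fin N) ℝ} {a : Coeff N K} {q γ M : ℝ}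

theorem sqrt_lt_of_lt_sq {x : ℝ} (h : x < (N : ℝ) ^ 2) : √x < N :=
  (Real.sqrt_lt' (by exact_mod_cast NeZero.pos N)).2 h

theorem summable_and_tsum_le_of_le_gSeries {f : Level K → ℝ} {z : ℝ} (hM : 0 ≤ M) (hz : 0 ≤ z)
    (hK : K = ⊤ → z < N) (hf0 : ∀ k, 0 ≤ f k) (hf : ∀ k, f k ≤ M * gSeries N q z k.1) :
    Summable f ∧ ∑' k, f k ≤ M * (1 + gFun q K N z) := by
  have hsum : ∀ S : Finset (Level K), ∑ k ∈ S, f k ≤ M * (1 + gFun q K N z) := fun S =>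
    calc ∑ k ∈ S, f k ≤ ∑ k ∈ S, M * gSeries N q z k.1 := sum_le_sum fun k _ => hf k
      _ = M * ∑ k ∈ S, gSeries N q z k.1 := (mul_sum _ _ _).symm
      _ ≤ _ := mul_le_mul_of_nonneg_left (sum_gSeries_le hz hK S) hM
  exact ⟨summable_of_sum_le hf0 hsum, Real.tsum_le_of_sum_le hf0 hsum⟩

theorem muHaf_le (hB : B ∈ matrixSpace N) (ha : Nonneg a) (hγ : 0 ≤ γ) (hM : 0 ≤ M)
    (hk : ∀ k : Level K,
      ∑ I, a k I * multiFactorial I.1 ≤ M * levelWeight q γ k.1 * mIdx N k.1)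
    (hK : K = ⊤ → 2 * γ * (bMin B)⁻¹ < (N : ℝ) ^ 2) :
    muHaf a B ≤ M * (1 + gFun q K N (√(2 * γ * (bMin B)⁻¹))) :=
  (summable_and_tsum_le_of_le_gSeries hM (Real.sqrt_nonneg _)
    (fun h => sqrt_lt_of_lt_sq (hK h)) (muTerm_nonneg hB ha) fun k =>
      sum_coeff_mul_le_gSeries hB ha hγ (hafRep_le_multiFactorial_div hB) (hk k)).2

theorem summable_gbspTerm_and_qGBSP_le (hB : B ∈ matrixSpace N) (ha : Nonneg a)
    (hμ : Summable (muTerm a B)) (hγ : 0 ≤ γ) (hM : 0 ≤ M)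
    (hk : ∀ k : Level K,
      ∑ I, a k I * multiFactorial I.1 ≤ M * levelWeight q γ k.1 * mIdx N k.1)
    (hK : K = ⊤ → 2 * γ * (bMin B)⁻¹ < (N : ℝ) ^ 2) :
    Summable (gbspTerm a B) ∧ qGBSP a B ≤
      muHaf a B * (M * (1 + gFun q K N (√(2 * γ * (bMin B)⁻¹)))) / dConst B := by
  have hμ0 := muTerm_nonneg hB ha
  have hi0 := invTerm_nonneg hB ha
  obtain ⟨hi, hle⟩ := summable_and_tsum_le_of_le_gSeries hM (Real.sqrt_nonneg _)
    (fun h => sqrt_lt_of_lt_sq (hK h)) hi0 fun k =>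
      sum_coeff_mul_le_gSeries (f := fun I => multiFactorial I / hafRep B I) hB ha hγ
        (multiFactorial_div_hafRep_le hB) (hk k)
  have hprod := hμ.mul_of_nonneg hi hμ0 hi0
  have hQ : qGBSP a B = muHaf a B * (∑' k, invTerm a B k) / dConst B := by
    rw [qGBSP, tsum_congr (gbspTerm_eq a B), ← hμ.tsum_mul_tsum hi hprod, muHaf, one_div_mul_eq_div]
  refine ⟨hprod.congr fun p => (gbspTerm_eq a B p).symm, ?_⟩
  have hd := dConst_pos hB
  have hμ0' : 0 ≤ muHaf a B := tsum_nonneg hμ0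
  rw [hQ]
  gcongr

theorem doubleFactorial_two_mul_add_le (k l : ℕ) :
    ((2 * (k + l) - 1)‼ : ℝ) ≤ 4 ^ k * k ! * (4 ^ l * l !) := by
  calc ((2 * (k + l) - 1)‼ : ℝ) ≤ 2 ^ (k + l) * (k + l)! := doubleFactorial_le _
    _ = 2 ^ (k + l) * ((k + l).choose l * k ! * l !) := by
        rw [← Nat.add_choose_mul_factorial_mul_factorial k l]
        push_cast
        rfl
    _ ≤ 2 ^ (k + l) * (2 ^ (k + l) * k ! * l !) := by
        gcongr
        exact_mod_cast Nat.choose_le_two_pow _ _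
    _ = 4 ^ k * k ! * (4 ^ l * l !) := by
        rw [show (4 : ℝ) = 2 * 2 by norm_num, mul_pow, mul_pow, pow_add]
        ring

theorem mcTerm_le_mul (hB : B ∈ matrixSpace N) (ha : Nonneg a) (hγ : 0 ≤ γ) (hM : 0 ≤ M)
    (hk : ∀ k : Level K, ∑ I, a k I ≤ M * levelWeight q γ k.1) (p : Level K × Level K) :
    mcTerm a B p ≤ M * (powWeight q p.1.1 * (4 * γ * bMax B) ^ p.1.1) *
      (M * (powWeight q p.2.1 * (4 * γ * bMax B) ^ p.2.1)) := by
  obtain ⟨⟨k, hkK⟩, l, hlK⟩ := p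
  have := bMax_pos hB
  have := sum_coeff_nonneg ha ⟨l, hlK⟩
  have := levelWeight_nonneg (q := q) hγ k
  have := levelWeight_nonneg (q := q) hγ l
  calc mcTerm a B (⟨k, hkK⟩, ⟨l, hlK⟩)
      ≤ (∑ I, a ⟨k, hkK⟩ I) * (∑ J, a ⟨l, hlK⟩ J) * (bMax B ^ (k + l) * (2 * (k + l) - 1)‼) :=
        mcTerm_le (fun i j => (hB.1 i j).le) (le_bMax B) ha _
    _ ≤ M * levelWeight q γ k * (M * levelWeight q γ l) *
          (bMax B ^ (k + l) * (4 ^ k * k ! * (4 ^ l * l !))) := by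
        gcongr
        · exact hk _
        · exact hk _
        · exact doubleFactorial_two_mul_add_le k l
    _ = _ := by
        simp only [levelWeight, mul_pow, pow_add]
        field_simp

theorem summable_mcTerm (hB : B ∈ matrixSpace N) (ha : Nonneg a) (hγ : 0 ≤ γ) (hM : 0 ≤ M)
    (hk : ∀ k : Level K, ∑ I, a k I ≤ M * levelWeight q γ k.1)
    (hK : K = ⊤ → 4 * γ * bMax B < 1) : Summable (mcTerm a B) := by
  have := bMax_pos hB
  have hz : 0 ≤ 4 * γ * bMax B := by positivity
  have hs := ((hasSum_one_add_polylog (K := K) (s := -q) 1 hz hK).summable.congr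
    (g := fun k => powWeight q k.1 * (4 * γ * bMax B) ^ k.1) fun k => by
      unfold powWeight
      split_ifs with h
      · simp [h]
      · rw [one_mul, Real.rpow_neg (Nat.cast_nonneg _), div_inv_eq_mul, mul_comm]).mul_left M
  have h0 : ∀ k : Level K, 0 ≤ M * (powWeight q k.1 * (4 * γ * bMax B) ^ k.1) := fun k => by
    have := powWeight_pos q k.1
    positivity
  exact (hs.mul_of_nonneg hs h0 h0).of_nonneg_of_le (mcTerm_nonneg hB ha)
    (mcTerm_le_mul hB ha hγ hM hk)

end UpperBounds

section LowerBound

/-- The factor `ρ` in `2 √π R_{q,K} = ρ Li_{s,K}`. -/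
def rScale (q : ℝ) : ℝ := if 0 ≤ q then (2 : ℝ) ^ (-q) else 1

/-- The order `s` of the polylogarithm in `2 √π R_{q,K} = ρ Li_{s,K}`. -/
def rOrder (q : ℝ) : ℝ := if 0 ≤ q then 1 / 2 - q else 1 / 2 - 2 * q

variable {q γ : ℝ}

theorem rScale_nonneg (q : ℝ) : 0 ≤ rScale q := by
  unfold rScale
  split_ifs <;> positivity

theorem two_mul_rFun (q : ℝ) (K : ℕ∞) (z : ℝ) :
    2 * eConst * rFun q K z = rScale q * (1 / √Real.pi * eConst) * polylog (rOrder q) K z := by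
  unfold rFun rScale rOrder
  split_ifs <;> field_simp

theorem two_rpow_neg_mul_add_rpow_le (hq : 0 ≤ q) {k l : ℕ} (h : 1 ≤ k + l) :
    (2 : ℝ) ^ (-q) * ((k + l : ℕ) : ℝ) ^ q ≤ powWeight q k * powWeight q l := by
  have h2 : (2 : ℝ) ^ (-q) ≤ 1 :=
    Real.rpow_le_one_of_one_le_of_nonpos one_le_two (neg_nonpos.2 hq)
  rcases Nat.eq_zero_or_pos k with rfl | hk
  · rw [zero_add] at h ⊢
    rw [powWeight_of_one_le h, show powWeight q 0 = 1 from if_pos rfl, one_mul]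
    exact mul_le_of_le_one_left (by positivity) h2
  rcases Nat.eq_zero_or_pos l with rfl | hl
  · rw [powWeight_of_one_le hk, show powWeight q 0 = 1 from if_pos rfl, mul_one]
    exact mul_le_of_le_one_left (by positivity) h2
  have hk' : (1 : ℝ) ≤ k := by exact_mod_cast hk
  have hl' : (1 : ℝ) ≤ l := by exact_mod_cast hl
  rw [powWeight_of_one_le hk, powWeight_of_one_le hl, Real.rpow_neg zero_le_two, inv_mul_eq_div,
    ← Real.div_rpow (by positivity) zero_le_two, ← Real.mul_rpow (by positivity) (by positivity)]
  refine Real.rpow_le_rpow (by positivity) ?_ hq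
  push_cast
  nlinarith

theorem rpow_le_powWeight (hq : q ≤ 0) {m n : ℕ} (hn : 1 ≤ n) (h : m ≤ n) :
    (n : ℝ) ^ q ≤ powWeight q m := by
  rcases Nat.eq_zero_or_pos m with rfl | hm
  · exact Real.rpow_le_one_of_one_le_of_nonpos (by exact_mod_cast hn) hq
  · rw [powWeight_of_one_le hm]
    exact Real.rpow_le_rpow_of_nonpos (by exact_mod_cast hm) (by exact_mod_cast h) hq

theorem rScale_mul_le_powWeight_mul (q : ℝ) {k l : ℕ} (h : 1 ≤ k + l) :
    rScale q * √(k + l : ℕ) / ((k + l : ℕ) : ℝ) ^ rOrder q ≤ powWeight q k * powWeight q l := by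
  have hn : (0 : ℝ) < (k + l : ℕ) := by exact_mod_cast h
  rw [mul_div_assoc, Real.sqrt_eq_rpow, ← Real.rpow_sub hn]
  unfold rScale rOrder
  split_ifs with hq
  · rw [sub_sub_cancel]
    exact two_rpow_neg_mul_add_rpow_le hq h
  · have hq' := (not_le.1 hq).le
    rw [sub_sub_cancel, one_mul, two_mul, Real.rpow_add hn]
    exact mul_le_mul (rpow_le_powWeight hq' h (by omega)) (rpow_le_powWeight hq' h (by omega))
      (by positivity) (powWeight_pos q k).le

theorem sum_antidiagonal_inv_factorial (n : ℕ) :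
    ∑ p ∈ antidiagonal n, 1 / ((p.1 ! : ℝ) * p.2 !) = 2 ^ n / n ! := by
  have h := (Commute.all (1 : ℝ) 1).add_pow' n
  rw [one_add_one_eq_two] at h
  rw [h, sum_div]
  refine sum_congr rfl fun p hp => ?_
  simp only [one_pow, mul_one, nsmul_eq_mul]
  rw [← mem_antidiagonal.1 hp, Nat.cast_add_choose]
  field_simp

/-- The contribution of the levels `p = (k, l)` to the lower bound for `Q^{MC}`, when all entries
of the matrix are at least `b`. -/
def mcLower (q γ b : ℝ) (p : ℕ × ℕ) : ℝ :=
  levelWeight q γ p.1 * levelWeight q γ p.2 * (b ^ (p.1 + p.2) * (2 * (p.1 + p.2) - 1)‼)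

theorem le_sum_antidiagonal_mcLower (q : ℝ) {b : ℝ} (hγ : 0 ≤ γ) (hb : 0 ≤ b) {n : ℕ}
    (hn : 1 ≤ n) :
    rScale q * (1 / √Real.pi * eConst) * ((4 * γ * b) ^ n / (n : ℝ) ^ rOrder q) ≤
      ∑ p ∈ antidiagonal n, mcLower q γ b p := by
  have : (0 : ℝ) < n := by exact_mod_cast hn
  have := rScale_nonneg q
  set w := rScale q * √n / (n : ℝ) ^ rOrder q with hw
  have hwle : ∀ p ∈ antidiagonal n, w ≤ powWeight q p.1 * powWeight q p.2 := fun p hp => by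
    rw [hw, ← mem_antidiagonal.1 hp]
    exact rScale_mul_le_powWeight_mul q (by rw [mem_antidiagonal.1 hp]; exact hn)
  calc rScale q * (1 / √Real.pi * eConst) * ((4 * γ * b) ^ n / (n : ℝ) ^ rOrder q)
      = 1 / √Real.pi * eConst / √n * (w * (4 * γ * b) ^ n) := by
        rw [hw]
        field_simp
    _ ≤ centralRatio n * (w * (4 * γ * b) ^ n) := by
        refine mul_le_mul_of_nonneg_right (eConst_div_lt_centralRatio hn).le ?_
        positivity
    _ = w * γ ^ n * (b ^ n * (2 * n - 1)‼) * (2 ^ n / n !) := by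
        rw [doubleFactorial_eq_centralRatio_mul, show (4 : ℝ) = 2 * 2 by norm_num]
        simp only [mul_pow]
        field_simp
    _ = ∑ p ∈ antidiagonal n,
          w * γ ^ n * (b ^ n * (2 * n - 1)‼) * (1 / ((p.1 ! : ℝ) * p.2 !)) := by
        rw [← mul_sum, sum_antidiagonal_inv_factorial]
    _ ≤ ∑ p ∈ antidiagonal n, powWeight q p.1 * powWeight q p.2 * γ ^ n *
          (b ^ n * (2 * n - 1)‼) * (1 / ((p.1 ! : ℝ) * p.2 !)) := by
        gcongr with p hp
        exact hwle p hp
    _ = ∑ p ∈ antidiagonal n, mcLower q γ b p := by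
        refine sum_congr rfl fun p hp => ?_
        rw [← mem_antidiagonal.1 hp, mcLower, levelWeight, levelWeight, pow_add γ]
        field_simp

/-- The pairs of levels `(k, l)` with `k + l ≤ K`, grouped by `n = k + l`. -/
def antidiagonalEmbedding (K : ℕ∞) : (Σ n : Level K, antidiagonal n.1) ↪ Level K × Level K where
  toFun x := (⟨x.2.1.1, (Nat.cast_le.2 (HasAntidiagonal.antidiagonal.fst_le x.2.2)).trans x.1.2⟩,
    ⟨x.2.1.2, (Nat.cast_le.2 (HasAntidiagonal.antidiagonal.snd_le x.2.2)).trans x.1.2⟩)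
  inj' := by
    rintro ⟨⟨n, hn⟩, p, hp⟩ ⟨⟨m, hm⟩, p', hp'⟩ h
    simp only [Prod.mk.injEq, Subtype.mk.injEq] at h
    obtain rfl : p = p' := Prod.ext h.1 h.2
    obtain rfl : n = m := (mem_antidiagonal.1 hp).symm.trans (mem_antidiagonal.1 hp')
    rfl

variable {N : ℕ} {K : ℕ∞} {B : Matrix (Fin N) (Fin N) ℝ} {a : Coeff N K}

theorem tsum_lt_tsum_of_le_sum_antidiagonal {f : Level K × Level K → ℝ} {r : Level K → ℝ}
    (hf0 : ∀ p, 0 ≤ f p) (hf : Summable f) (hr : Summable r)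
    (hrf : ∀ n, r n ≤ ∑ x, f (antidiagonalEmbedding K ⟨n, x⟩)) {m : Level K}
    (hm : r m < ∑ x, f (antidiagonalEmbedding K ⟨m, x⟩)) : ∑' n, r n < ∑' p, f p := by
  have hinj := (antidiagonalEmbedding K).injective
  have hs : Summable (f ∘ antidiagonalEmbedding K) := hf.comp_injective hinj
  have hsσ : HasSum (fun n => ∑ x, f (antidiagonalEmbedding K ⟨n, x⟩))
      (∑' x, (f ∘ antidiagonalEmbedding K) x) :=
    hs.hasSum.sigma fun n => hasSum_fintype _
  calc ∑' n, r n < ∑' n, ∑ x, f (antidiagonalEmbedding K ⟨n, x⟩) :=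
        Summable.tsum_lt_tsum hrf hm hr hsσ.summable
    _ = ∑' x, (f ∘ antidiagonalEmbedding K) x := hsσ.tsum_eq
    _ ≤ ∑' p, f p := tsum_comp_le_tsum_of_inj hf hf0 hinj

theorem le_sum_antidiagonalEmbedding_zero {f : Level K × Level K → ℝ} (hf : ∀ p, 0 ≤ f p)
    (h : ((0 : ℕ) : ℕ∞) ≤ K) :
    f (⟨0, h⟩, ⟨0, h⟩) ≤ ∑ x, f (antidiagonalEmbedding K ⟨⟨0, h⟩, x⟩) := by
  have h00 : ((0, 0) : ℕ × ℕ) ∈ antidiagonal 0 := mem_antidiagonal.2 rfl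
  exact single_le_sum (f := fun x => f (antidiagonalEmbedding K ⟨⟨0, h⟩, x⟩))
    (fun x _ => hf _) (mem_univ ⟨(0, 0), h00⟩)

theorem mul_mcLower_le_mcTerm [NeZero N] (hB : B ∈ matrixSpace N) (ha : Nonneg a) (hγ : 0 ≤ γ)
    {L : ℝ} (hL : 0 ≤ L) (hk : ∀ k : Level K, L * levelWeight q γ k.1 ≤ ∑ I, a k I)
    (p : Level K × Level K) : L ^ 2 * mcLower q γ (bMin B) (p.1.1, p.2.1) ≤ mcTerm a B p := by
  have hb := bMin_pos hB
  have := levelWeight_nonneg (q := q) hγ p.2.1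
  have := sum_coeff_nonneg ha p.1
  calc _ = L * levelWeight q γ p.1.1 * (L * levelWeight q γ p.2.1) *
        (bMin B ^ (p.1.1 + p.2.1) * (2 * (p.1.1 + p.2.1) - 1)‼) := by
        rw [mcLower]
        ring
    _ ≤ (∑ I, a p.1 I) * (∑ J, a p.2 J) *
          (bMin B ^ (p.1.1 + p.2.1) * (2 * (p.1.1 + p.2.1) - 1)‼) := by
        gcongr
        exacts [hk _, hk _]
    _ ≤ mcTerm a B p := le_mcTerm hb.le (bMin_le B) ha p

theorem coeffZero_sq_le_mcTerm [NeZero N] (hB : B ∈ matrixSpace N) (ha : Nonneg a)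
    (h : ((0 : ℕ) : ℕ∞) ≤ K) : coeffZero a ^ 2 ≤ mcTerm a B (⟨0, h⟩, ⟨0, h⟩) := by
  have := le_mcTerm (bMin_pos hB).le (bMin_le B) ha (⟨0, h⟩, ⟨0, h⟩)
  simpa [sum_coeff_zero, ← sq] using this

theorem lt_qMC [NeZero N] (hB : B ∈ matrixSpace N) (ha : Nonneg a) (hs : Summable (mcTerm a B))
    {L : ℝ} (hγ : 0 ≤ γ) (hL : 0 ≤ L) (h0 : L < coeffZero a)
    (hk : ∀ k : Level K, L * levelWeight q γ k.1 ≤ ∑ I, a k I)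
    (hK : K = ⊤ → 4 * γ * bMin B < 1) :
    L ^ 2 * (1 + 2 * eConst * rFun q K (4 * γ * bMin B)) < qMC a B := by
  have hb := bMin_pos hB
  have hr := (hasSum_one_add_polylog (K := K) (s := rOrder q)
    (rScale q * (1 / √Real.pi * eConst)) (z := 4 * γ * bMin B) (by positivity) hK).mul_left (L ^ 2)
  rw [two_mul_rFun, ← hr.tsum_eq]
  have hzero (h : ((0 : ℕ) : ℕ∞) ≤ K) :
      L ^ 2 < ∑ x, mcTerm a B (antidiagonalEmbedding K ⟨⟨0, h⟩, x⟩) :=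
    ((pow_lt_pow_left₀ h0 hL two_ne_zero).trans_le (coeffZero_sq_le_mcTerm hB ha h)).trans_le
      (le_sum_antidiagonalEmbedding_zero (mcTerm_nonneg hB ha) h)
  refine tsum_lt_tsum_of_le_sum_antidiagonal (mcTerm_nonneg hB ha) hs hr.summable (fun n => ?_)
    (m := ⟨0, zero_le⟩) (by simpa using hzero _)
  obtain ⟨n, hnK⟩ := n
  rcases Nat.eq_zero_or_pos n with rfl | hn
  · simpa using (hzero hnK).le
  · rw [if_neg hn.ne']
    calc _ ≤ L ^ 2 * ∑ p ∈ antidiagonal n, mcLower q γ (bMin B) p :=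
          mul_le_mul_of_nonneg_left (le_sum_antidiagonal_mcLower q hγ hb.le hn) (sq_nonneg L)
      _ = ∑ x : antidiagonal n, L ^ 2 * mcLower q γ (bMin B) x.1 := by
          rw [mul_sum, ← sum_coe_sort]
      _ ≤ _ := sum_le_sum fun x _ =>
          mul_mcLower_le_mcTerm hB ha hγ hL hk (antidiagonalEmbedding K ⟨⟨n, hnK⟩, x⟩)

end LowerBound

section SampleSizes

variable {N : ℕ} {K : ℕ∞} {B : Matrix (Fin N) (Fin N) ℝ} {a : Coeff N K} {γ q γα γβ qα qβ : ℝ}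

theorem mul_exp_lt_of_log_bound {s₁ s₂ t x y Y Z : ℝ} (hs₁ : 0 < s₁) (ht : 0 < t) (hZ : 0 < Z)
    (hY : 1 ≤ Y) (hy : y ≤ Y) (hx : Z < x)
    (h : s₁ / t * Y ≤ Real.log Z - Real.log (t + 1) + s₁ / t - Real.log (max s₂ 1)) :
    s₂ * Real.exp (s₁ * ((y - 1) / t)) < (x - 1) / t := by
  set m := max s₂ 1
  have hm : 1 ≤ m := le_max_right _ _
  set E := Real.exp (s₁ * ((Y - 1) / t))
  have hE : 1 ≤ E := Real.one_le_exp (mul_nonneg hs₁.le (div_nonneg (by linarith) ht.le))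
  have hEZ : E * ((t + 1) * m) ≤ Z := by
    rw [← le_div_iff₀ (by positivity), ← Real.le_log_iff_exp_le (by positivity),
      Real.log_div (by positivity) (by positivity), Real.log_mul (by positivity) (by positivity)]
    have : s₁ * ((Y - 1) / t) = s₁ / t * Y - s₁ / t := by ring
    linarith
  calc s₂ * Real.exp (s₁ * ((y - 1) / t)) ≤ m * E := by
        exact mul_le_mul (le_max_left _ _) (Real.exp_le_exp.2 (by gcongr)) (Real.exp_pos _).le
          (by linarith)
    _ = (m * E * (t + 1) - m * E) / t := by
        field_simp
        ring
    _ ≤ (Z - 1) / t := by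
        have := one_le_mul_of_one_le_of_one_le hm hE
        gcongr
        linarith
    _ < (x - 1) / t := by gcongr

theorem rFun_nonneg (q : ℝ) (K : ℕ∞) {z : ℝ} (hz : 0 ≤ z) : 0 ≤ rFun q K z := by
  have := polylog_nonneg (1 / 2 - q) K hz
  have := polylog_nonneg (1 / 2 - 2 * q) K hz
  unfold rFun
  split_ifs <;> positivity

theorem one_le_cOne [NeZero N] (hB : B ∈ matrixSpace N) (hγ : 0 ≤ γ) : 1 ≤ cOne K γ q B := by
  have := bMin_pos hB
  exact le_add_of_nonneg_right (mul_nonneg inv_sqrt_pi_mul_eConst_pos.le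
    (polylog_nonneg _ K (by positivity)))

theorem cOne_pos [NeZero N] (hB : B ∈ matrixSpace N) (hγ : 0 ≤ γ) : 0 < cOne K γ q B :=
  one_pos.trans_le (one_le_cOne hB hγ)

theorem cTwo_pos [NeZero N] (hB : B ∈ matrixSpace N) (hγ : 0 ≤ γ) : 0 < cTwo K γ q B := by
  have := bMax_pos hB
  have := polylog_nonneg (1 / 2 - q) K (z := 2 * γ * bMax B) (by positivity)
  unfold cTwo
  positivity

theorem le_of_forall_mul_rpow_mul_pow_le {c c' : ℝ} (hα : 0 < γα) (hβ : 0 < γβ) (hc : 0 < c)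
    (hc' : 0 < c') (h : ∀ k : ℕ, 1 ≤ k →
      c * ((k : ℝ) ^ qα * γα ^ k) ≤ c' * ((k : ℝ) ^ qβ * γβ ^ k)) : γα ≤ γβ := by
  by_contra! hlt
  have htendsto := (summable_polylogTerm_top (s := qα - qβ) (z := γβ / γα) (by positivity)
    ((div_lt_one hα).2 hlt)).tendsto_atTop_zero
  refine (div_pos hc hc').not_ge (ge_of_tendsto htendsto ?_)
  filter_upwards [Filter.eventually_ge_atTop 1] with k hk
  have hk0 : (0 : ℝ) < k := by exact_mod_cast hk
  rw [polylogTerm_of_le hk le_top, div_pow, Real.rpow_sub hk0, div_div_div_eq,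
    div_le_div_iff₀ hc' (by positivity), mul_comm (γα ^ k), mul_comm (_ * _) c',
    mul_comm (γβ ^ k)]
  exact h k hk

theorem four_mul_mul_bMin_lt_one [NeZero N] {ε δ s₁ s₂ : ℝ} (hα : 0 < γα) (hβ : 0 < γβ)
    (hB : B ∈ matrixSubset N K ε δ s₁ s₂ γα γβ qα qβ) (hK : K = ⊤) : 4 * γα * bMin B < 1 := by
  obtain ⟨hB, -, hpow, -, h⟩ := hB
  have hb := bMin_pos hB
  have hγ : γα ≤ γβ := le_of_forall_mul_rpow_mul_pow_le hα hβ (inv_pos.2 (cTwo_pos hB hβ.le))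
    (inv_pos.2 (cOne_pos hB hα.le)) fun k hk => (hpow k hk (hK ▸ le_top)).le
  calc 4 * γα * bMin B ≤ 4 * γβ * bMax B := by
        gcongr
        exact bMin_le_bMax
    _ < 1 := (h hK).1

namespace CoeffConditions

theorem muHaf_ne_zero (h : CoeffConditions γα γβ qα qβ a B) (ha : Nonneg a) : muHaf a B ≠ 0 := by
  intro h0
  have h1 := h.2.2.1
  rw [h0, mul_zero] at h1
  exact h1.not_ge (ha _ _)

theorem summable_muTerm (h : CoeffConditions γα γβ qα qβ a B) (ha : Nonneg a) :
    Summable (muTerm a B) :=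
  not_imp_comm.1 tsum_eq_zero_of_not_summable (h.muHaf_ne_zero ha)

theorem muHaf_pos [NeZero N] (h : CoeffConditions γα γβ qα qβ a B) (ha : Nonneg a)
    (hB : B ∈ matrixSpace N) : 0 < muHaf a B :=
  (tsum_nonneg (muTerm_nonneg hB ha)).lt_of_ne' (h.muHaf_ne_zero ha)

theorem le_sum_coeff (h : CoeffConditions γα γβ qα qβ a B) (k : Level K) :
    (cTwo K γβ qβ B)⁻¹ * muHaf a B * levelWeight qα γα k.1 ≤ ∑ I, a k I := by
  obtain ⟨k, hk⟩ := k
  rcases Nat.eq_zero_or_pos k with rfl | h1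
  · rw [levelWeight_zero, mul_one, sum_coeff_zero]
    exact h.2.1.le
  · rw [levelWeight_of_one_le h1]
    exact (h.2.2.2 ⟨k, hk⟩ h1).1

theorem sum_coeff_le (h : CoeffConditions γα γβ qα qβ a B) (k : Level K) :
    ∑ I, a k I ≤ (cOne K γα qα B)⁻¹ * muHaf a B * levelWeight qβ γβ k.1 := by
  obtain ⟨k, hk⟩ := k
  rcases Nat.eq_zero_or_pos k with rfl | h1
  · rw [levelWeight_zero, mul_one, sum_coeff_zero]
    exact h.2.2.1.le
  · rw [levelWeight_of_one_le h1]
    exact (h.2.2.2 ⟨k, hk⟩ h1).2.1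

theorem sum_coeff_mul_multiFactorial_le [NeZero N] (h : CoeffConditions γα γβ qα qβ a B)
    (k : Level K) : ∑ I, a k I * multiFactorial I.1 ≤
      (cOne K γα qα B)⁻¹ * muHaf a B * levelWeight qβ γβ k.1 * mIdx N k.1 := by
  obtain ⟨k, hk⟩ := k
  rcases Nat.eq_zero_or_pos k with rfl | h1
  · rw [sum_coeff_mul_zero]
    simpa [levelWeight_zero, mIdx_of_two_mul_le, multiFactorial] using h.2.2.1.le
  · rw [levelWeight_of_one_le h1]
    exact (h.2.2.2 ⟨k, hk⟩ h1).2.2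

end CoeffConditions

theorem sub_div_mul_mul_eq {Q m ε δ : ℝ} (hm : m ≠ 0) :
    (Q - m ^ 2) / (δ * ε ^ 2 * m ^ 2) = (Q / m ^ 2 - 1) / (ε ^ 2 * δ) := by
  rw [mul_comm δ, mul_comm _ (m ^ 2), ← div_div, sub_div, div_self (pow_ne_zero 2 hm)]

theorem mem_coeffSpace_and_mul_exp_nGBSP_lt_nMC [NeZero N] {ε δ s₁ s₂ : ℝ} (hε : 0 < ε)
    (hδ : 0 < δ) (hs₁ : 0 < s₁) (hα : 0 < γα) (hβ : 0 < γβ)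
    (hB : B ∈ matrixSubset N K ε δ s₁ s₂ γα γβ qα qβ) (ha : Nonneg a)
    (h : CoeffConditions γα γβ qα qβ a B) :
    a ∈ coeffSpace K B ∧ s₂ * Real.exp (s₁ * nGBSP ε δ a B) < nMC ε δ a B := by
  have hz := four_mul_mul_bMin_lt_one hα hβ hB
  obtain ⟨hB, -, -, hlog, hK⟩ := hB
  have hμ := h.muHaf_pos ha hB
  have hμs := h.summable_muTerm ha
  have hc₁ : 0 < (cOne K γα qα B)⁻¹ := inv_pos.2 (cOne_pos hB hα.le)
  have hc₂ : 0 < (cTwo K γβ qβ B)⁻¹ := inv_pos.2 (cTwo_pos hB hβ.le)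
  have hfac := h.sum_coeff_mul_multiFactorial_le
  obtain ⟨hgs, hQ⟩ := summable_gbspTerm_and_qGBSP_le hB ha hμs hβ.le (by positivity) hfac
    fun h => (hK h).2
  have hμle := muHaf_le hB ha hβ.le (by positivity) hfac fun h => (hK h).2
  have hmc := summable_mcTerm hB ha hβ.le (by positivity) h.sum_coeff_le fun h => (hK h).1
  have hX := lt_qMC hB ha hmc hα.le (by positivity) h.2.1 h.le_sum_coeff hz
  refine ⟨⟨ha, hμs, hμ.ne', hgs, hmc⟩, ?_⟩
  have hd := dConst_pos hB
  have hR := rFun_nonneg qα K (z := 4 * γα * bMin B) (by have := bMin_pos hB; positivity)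
  have := eConst_pos
  set G := gFun qβ K N (√(2 * γβ * (bMin B)⁻¹))
  have hY : 1 ≤ (cOne K γα qα B)⁻¹ / dConst B * (1 + G) := by
    have h1 : 1 ≤ (cOne K γα qα B)⁻¹ * (1 + G) := by
      refine le_of_mul_le_mul_right ?_ hμ
      linarith
    rw [div_mul_eq_mul_div, one_le_div₀ hd]
    exact (dConst_le_one (isHermitian_of_mem_matrixSpace hB)).trans h1
  rw [nGBSP, nMC, sub_div_mul_mul_eq hμ.ne', sub_div_mul_mul_eq hμ.ne']
  refine mul_exp_lt_of_log_bound hs₁ (by positivity) (Z := (cTwo K γβ qβ B)⁻¹ ^ 2 *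
    (1 + 2 * eConst * rFun qα K (4 * γα * bMin B))) (by positivity) hY ?_ ?_ ?_
  · rw [div_le_iff₀ (by positivity)]
    exact hQ.trans_eq (by ring)
  · rw [lt_div_iff₀ (by positivity)]
    exact hX.trans_eq' (by ring)
  · rw [Real.log_mul (by positivity) (by positivity), Real.log_pow]
    push_cast
    linarith

end SampleSizes

section CentralSeries

variable {K : ℕ∞} {s z z' : ℝ}

/-- The series `∑_{k ≤ K} binom(2k, k) (z / 4)^k`: when all entries of `B` are equal to `b`, it is
the value at `z = 2γb` of `μ` for coefficients with level sums `γ^k / k!`. -/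
def centralSeries (K : ℕ∞) (z : ℝ) : ℝ := ∑' k : Level K, centralRatio k.1 * z ^ k.1

theorem summable_centralSeries (hz : 0 ≤ z) (h : z < 1) :
    Summable fun k : Level K => centralRatio k.1 * z ^ k.1 := by
  refine ((summable_geometric_of_lt_one hz h).comp_injective Subtype.val_injective).of_nonneg_of_le
    (fun k => mul_nonneg (centralRatio_pos _).le (pow_nonneg hz _)) fun k => ?_
  exact mul_le_of_le_one_left (pow_nonneg hz _) (centralRatio_le_one _)

theorem centralSeries_mono (hz : 0 ≤ z) (hzz : z ≤ z') (h : z' < 1) :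
    centralSeries K z ≤ centralSeries K z' := by
  refine (summable_centralSeries hz (hzz.trans_lt h)).tsum_le_tsum (fun k => ?_)
    (summable_centralSeries (hz.trans hzz) h)
  have := (centralRatio_pos k.1).le
  gcongr

theorem tsum_add_le_tsum_of_le {ι : Type*} {f g : ι → ℝ} {c : ℝ} (hf : Summable f)
    (hg : Summable g) (hle : ∀ i, f i ≤ g i) (i : ι) (hi : f i + c ≤ g i) :
    ∑' i, f i + c ≤ ∑' i, g i := by
  have h := (hg.sub hf).le_tsum i fun j _ => sub_nonneg.2 (hle j)
  rw [hg.tsum_sub hf] at h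
  linarith

theorem one_add_mul_polylog_add_le_centralSeries (hK : 1 ≤ K) (hz : 0 ≤ z) (h : z < 1) :
    1 + 1 / √Real.pi * eConst * polylog (1 / 2) K z + (1 / 2 - 1 / √Real.pi * eConst) * z ≤
      centralSeries K z := by
  have hs := hasSum_one_add_polylog (K := K) (s := 1 / 2) (1 / √Real.pi * eConst) hz fun _ => h
  rw [← hs.tsum_eq]
  refine tsum_add_le_tsum_of_le hs.summable (summable_centralSeries hz h) (fun k => ?_)
    ⟨1, by simpa using hK⟩ ?_
  · split_ifs with hk
    · simp [hk, centralRatio_zero]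
    · rw [← Real.sqrt_eq_rpow, ← mul_div_assoc, mul_div_right_comm]
      exact mul_le_mul_of_nonneg_right
        (eConst_div_lt_centralRatio (Nat.one_le_iff_ne_zero.2 hk)).le (pow_nonneg hz _)
  · simp only [one_ne_zero, if_false, centralRatio_one, pow_one, Nat.cast_one, Real.one_rpow]
    exact le_of_eq (by ring)

theorem centralSeries_add_le_one_add_mul_polylog (hK : 1 ≤ K) (hz : 0 ≤ z) (h : z < 1) :
    centralSeries K z + (1 / √Real.pi - 1 / 2) * z ≤ 1 + 1 / √Real.pi * polylog (1 / 2) K z := by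
  have hs := hasSum_one_add_polylog (K := K) (s := 1 / 2) (1 / √Real.pi) hz fun _ => h
  rw [← hs.tsum_eq]
  refine tsum_add_le_tsum_of_le (summable_centralSeries hz h) hs.summable (fun k => ?_)
    ⟨1, by simpa using hK⟩ ?_
  · split_ifs with hk
    · simp [hk, centralRatio_zero]
    · rw [← Real.sqrt_eq_rpow, ← mul_div_assoc, mul_div_right_comm]
      exact mul_le_mul_of_nonneg_right
        (centralRatio_le (Nat.one_le_iff_ne_zero.2 hk)) (pow_nonneg hz _)
  · simp only [one_ne_zero, if_false, centralRatio_one, pow_one, Nat.cast_one, Real.one_rpow]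
    exact le_of_eq (by ring)

theorem polylog_le_div (hs : 0 ≤ s) (hz : 0 ≤ z) (h : z < 1) : polylog s K z ≤ z / (1 - z) := by
  have hsum := summable_polylogTerm (s := s) (K := K) hz fun _ => h
  have hle (k : ℕ) : polylogTerm s K z (k + 1) ≤ z * z ^ k := by
    rw [← pow_succ']
    unfold polylogTerm
    split_ifs
    · exact div_le_self (by positivity)
        (Real.one_le_rpow (by exact_mod_cast Nat.succ_pos k) hs)
    · positivity
  calc polylog s K z = ∑' k : ℕ, polylogTerm s K z (k + 1) := by
        rw [polylog_eq_tsum, hsum.tsum_eq_zero_add, polylogTerm, if_neg (by simp), zero_add]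
    _ ≤ ∑' k : ℕ, z * z ^ k := ((summable_nat_add_iff 1).2 hsum).tsum_le_tsum hle
        ((summable_geometric_of_lt_one hz h).mul_left z)
    _ = z / (1 - z) := by rw [tsum_mul_left, tsum_geometric_of_lt_one hz h, div_eq_mul_inv]

theorem one_add_mul_polylog_le_two (hz : 0 ≤ z) (h : z ≤ 1 / 2) :
    1 + 1 / √Real.pi * polylog (1 / 2) K z ≤ 2 := by
  have hπ : 1 / √Real.pi ≤ 1 := by
    rw [div_le_one (Real.sqrt_pos.2 Real.pi_pos), Real.one_le_sqrt]
    linarith [Real.pi_gt_three]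
  have hp : polylog (1 / 2) K z ≤ 1 := by
    refine (polylog_le_div one_half_pos.le hz (by linarith)).trans ?_
    rw [div_le_one (by linarith)]
    linarith
  linarith [mul_le_one₀ hπ (polylog_nonneg (1 / 2) K hz) hp]

/-- The relative deviation of the coefficients that is admissible on `coeffBox`: a tenth of the
smaller of the gaps at `k = 1` between `binom(2k, k) / 4^k` and its two bounds in `c_1`, `c_2`. -/
def margin : ℝ := min (1 / 2 - 1 / √Real.pi * eConst) (1 / √Real.pi - 1 / 2) / 10

theorem margin_pos : 0 < margin := by
  have hπ : √Real.pi < 2 := (Real.sqrt_lt' two_pos).2 (by linarith [Real.pi_lt_four])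
  have := one_div_lt_one_div_of_lt (Real.sqrt_pos.2 Real.pi_pos) hπ
  exact div_pos (lt_min (sub_pos.2 inv_sqrt_pi_mul_eConst_lt) (sub_pos.2 this)) (by norm_num)

theorem ten_mul_margin_le_left : 10 * margin ≤ 1 / 2 - 1 / √Real.pi * eConst := by
  rw [margin, mul_div_cancel₀ _ (by norm_num)]
  exact min_le_left _ _

theorem ten_mul_margin_le_right : 10 * margin ≤ 1 / √Real.pi - 1 / 2 := by
  rw [margin, mul_div_cancel₀ _ (by norm_num)]
  exact min_le_right _ _

theorem margin_lt_one : margin < 1 := by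
  linarith [ten_mul_margin_le_left, inv_sqrt_pi_mul_eConst_pos]

theorem four_mul_margin_le {g : ℝ} (hg : 10 * margin ≤ g) (hz : 2 / 5 ≤ z) :
    4 * margin ≤ g * z := by
  nlinarith [margin_pos]

theorem one_add_margin_mul_le {x y : ℝ} (h : x + 4 * margin ≤ y) (hy : y ≤ 2) :
    (1 + margin) * x ≤ (1 - margin) * y := by
  nlinarith [margin_pos]

theorem centralSeries_add_four_mul_margin_le (hK : 1 ≤ K) (hz : 2 / 5 ≤ z) (h : z < 1) :
    centralSeries K z + 4 * margin ≤ 1 + 1 / √Real.pi * polylog (1 / 2) K z :=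
  (centralSeries_add_le_one_add_mul_polylog hK (by linarith) h).trans'
    (add_le_add_right (four_mul_margin_le ten_mul_margin_le_right hz) _)

theorem one_add_margin_mul_centralSeries_le (hK : 1 ≤ K) (hz : 2 / 5 ≤ z) (h : z ≤ 1 / 2) :
    (1 + margin) * centralSeries K z ≤
      (1 - margin) * (1 + 1 / √Real.pi * polylog (1 / 2) K z) :=
  one_add_margin_mul_le (centralSeries_add_four_mul_margin_le hK hz (by linarith))
    (one_add_mul_polylog_le_two (by linarith) h)

theorem one_add_margin_mul_le_centralSeries (hK : 1 ≤ K) (hz : 2 / 5 ≤ z) (h : z ≤ 1 / 2) :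
    (1 + margin) * (1 + 1 / √Real.pi * eConst * polylog (1 / 2) K z) ≤
      (1 - margin) * centralSeries K z := by
  refine one_add_margin_mul_le ((one_add_mul_polylog_add_le_centralSeries hK (by linarith)
    (by linarith)).trans' (add_le_add_right (four_mul_margin_le ten_mul_margin_le_left hz) _)) ?_
  linarith [margin_pos, centralSeries_add_four_mul_margin_le hK hz (by linarith),
    one_add_mul_polylog_le_two (K := K) (by linarith) h]

theorem sqrt_div_two_le_polylog {n : ℕ} (hn : 1 ≤ n) (hK : (n : ℕ∞) ≤ K) {ρ : ℝ} (hρ : 0 ≤ ρ)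
    (hρ1 : ρ ≤ 1) (hρz : ρ ≤ z) (hρn : 1 / 2 ≤ ρ ^ n) (hz : K = ⊤ → z < 1) :
    √n / 2 ≤ polylog (1 / 2) K z := by
  have hn0 : (0 : ℝ) < n := by exact_mod_cast hn
  have := Real.sqrt_pos.2 hn0
  have hterm : ∀ k ∈ Icc 1 n, 1 / 2 / √n ≤ polylogTerm (1 / 2) K z k := fun k hk => by
    obtain ⟨h1, h2⟩ := mem_Icc.1 hk
    have : (0 : ℝ) < k := by exact_mod_cast h1
    rw [polylogTerm_of_le h1 ((Nat.cast_le.2 h2).trans hK), ← Real.sqrt_eq_rpow]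
    have : 1 / 2 ≤ z ^ k :=
      hρn.trans ((pow_le_pow_of_le_one hρ hρ1 h2).trans (pow_le_pow_left₀ hρ hρz k))
    gcongr
  calc √n / 2 = ∑ k ∈ Icc 1 n, 1 / 2 / √n := by
        rw [sum_const, Nat.card_Icc, nsmul_eq_mul, Nat.add_sub_cancel]
        nth_rewrite 2 [← Real.mul_self_sqrt hn0.le]
        field_simp
    _ ≤ ∑ k ∈ Icc 1 n, polylogTerm (1 / 2) K z k := sum_le_sum hterm
    _ ≤ polylog (1 / 2) K z := by
        rw [polylog_eq_tsum]
        exact (summable_polylogTerm (hρ.trans hρz) hz).sum_le_tsum _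
          fun k _ => polylogTerm_nonneg _ _ (hρ.trans hρz) k

end CentralSeries

section EntryBox

variable {N : ℕ} {K : ℕ∞} {B : Matrix (Fin N) (Fin N) ℝ} {ρ ρ' : ℝ}

/-- The matrices with entries in `(4ρ / (5N), 4ρ' / (5N))`. For `ρ' ≤ 1` their eigenvalues are at
most `4/5`, which keeps `d` away from `0`. -/
def entryBox (N : ℕ) (ρ ρ' : ℝ) : Set (Matrix (Fin N) (Fin N) ℝ) :=
  {B | ∀ i j, 4 / (5 * N) * ρ < B i j ∧ B i j < 4 / (5 * N) * ρ'}

/-- The common value `5N / 16` of `γ_α` and `γ_β`, for which the entries `b` of a matrix in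
`entryBox N ρ ρ'` satisfy `ρ < 4γb < ρ'`. -/
def gammaVal (N : ℕ) : ℝ := 5 * N / 16

theorem isOpen_entryBox (N : ℕ) (ρ ρ' : ℝ) : IsOpen (entryBox N ρ ρ') := by
  simp only [entryBox, Set.ofPred_forall]
  refine isOpen_iInter_of_finite fun i => isOpen_iInter_of_finite fun j => ?_
  have hc : Continuous fun B : Matrix (Fin N) (Fin N) ℝ => B i j := continuous_id.matrix_elem i j
  exact (isOpen_lt continuous_const hc).inter (isOpen_lt hc continuous_const)

theorem abs_lt_of_mem_entryBox (hB : B ∈ matrixSpace N) (hV : B ∈ entryBox N ρ ρ') (i j : Fin N) :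
    |B i j| < 4 / (5 * N) * ρ' :=
  (abs_of_pos (hB.1 i j)).trans_lt (hV i j).2

theorem cOne_zero (K : ℕ∞) (γ : ℝ) (B : Matrix (Fin N) (Fin N) ℝ) :
    cOne K γ 0 B = 1 + 1 / √Real.pi * eConst * polylog (1 / 2) K (2 * γ * bMin B) := by
  rw [cOne, sub_zero]

theorem cTwo_zero (K : ℕ∞) (γ : ℝ) (B : Matrix (Fin N) (Fin N) ℝ) :
    cTwo K γ 0 B = 1 + 1 / √Real.pi * polylog (1 / 2) K (2 * γ * bMax B) := by
  rw [cTwo, sub_zero]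

theorem spectrum_pos_of_posDef (hB : B.PosDef) {l : ℝ} (hl : l ∈ spectrum ℝ B) : 0 < l := by
  rw [hB.isHermitian.spectrum_real_eq_range_eigenvalues] at hl
  obtain ⟨i, rfl⟩ := hl
  exact hB.eigenvalues_pos i

variable [NeZero N]

theorem gammaVal_pos : 0 < gammaVal N := by
  have : (0 : ℝ) < N := by exact_mod_cast NeZero.pos N
  unfold gammaVal
  positivity

theorem four_mul_gammaVal_mul (r : ℝ) : 4 * gammaVal N * (4 / (5 * N) * r) = r := by
  have : (0 : ℝ) < N := by exact_mod_cast NeZero.pos N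
  unfold gammaVal
  field_simp
  norm_num

theorem lt_four_mul_bMin (hV : B ∈ entryBox N ρ ρ') : ρ < 4 * gammaVal N * bMin B := by
  have := gammaVal_pos (N := N)
  calc ρ = 4 * gammaVal N * (4 / (5 * N) * ρ) := (four_mul_gammaVal_mul ρ).symm
    _ < _ := by
        gcongr
        exact lt_bMin fun i j => (hV i j).1

theorem four_mul_bMax_lt (hB : B ∈ matrixSpace N) (hV : B ∈ entryBox N ρ ρ') :
    4 * gammaVal N * bMax B < ρ' := by
  have := gammaVal_pos (N := N)
  calc _ < 4 * gammaVal N * (4 / (5 * N) * ρ') := by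
        gcongr
        exact bMax_lt (abs_lt_of_mem_entryBox hB hV)
    _ = ρ' := four_mul_gammaVal_mul ρ'

theorem two_mul_inv_bMin_le (hB : B ∈ matrixSpace N) (hρ : 9 / 10 ≤ ρ)
    (hV : B ∈ entryBox N ρ ρ') : 2 * gammaVal N * (bMin B)⁻¹ ≤ 7 / 8 * (N : ℝ) ^ 2 := by
  have hN : (0 : ℝ) < N := by exact_mod_cast NeZero.pos N
  have hlt := lt_four_mul_bMin hV
  unfold gammaVal at hlt ⊢
  have hNb : 18 / 25 ≤ N * bMin B := by linarith
  rw [← div_eq_mul_inv, div_le_iff₀ (bMin_pos hB)]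
  linarith [mul_le_mul_of_nonneg_left hNb hN.le]

theorem le_dConst_of_mem_entryBox (hB : B ∈ matrixSpace N) (hρ' : 0 ≤ ρ') (hρ'1 : ρ' ≤ 1)
    (hV : B ∈ entryBox N ρ ρ') : (3 / 5 : ℝ) ^ N ≤ dConst B := by
  have hN : (0 : ℝ) < N := by exact_mod_cast NeZero.pos N
  refine (pow_le_pow_left₀ (by norm_num) (Real.le_sqrt_of_sq_le ?_) N).trans
    (sqrt_pow_le_dConst (isHermitian_of_mem_matrixSpace hB)
      fun i j => (abs_lt_of_mem_entryBox hB hV i j).le)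
  rw [show (N : ℝ) * (4 / (5 * N) * ρ') = 4 / 5 * ρ' by field_simp]
  nlinarith

theorem gFun_le_of_mem_entryBox (hB : B ∈ matrixSpace N) (hρ : 9 / 10 ≤ ρ)
    (hV : B ∈ entryBox N ρ ρ') (q : ℝ) :
    gFun q K N (√(2 * gammaVal N * (bMin B)⁻¹)) ≤ gFun q ⊤ N (√(7 / 8) * N) := by
  have hN : (0 : ℝ) < N := by exact_mod_cast NeZero.pos N
  refine gFun_mono (Real.sqrt_nonneg _) ?_ (mul_lt_of_lt_one_left hN ?_)
  · rw [Real.sqrt_le_left (by positivity), mul_pow, Real.sq_sqrt (by norm_num)]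
    exact two_mul_inv_bMin_le hB hρ hV
  · rw [Real.sqrt_lt' one_pos]
    norm_num

/-- A bound, uniform in `K` and in the matrices of `entryBox`, for the value that the logarithm of
`1 + 2 e^{1/25 - 1/6} R_{0,K}` has to reach in condition 2 defining `𝓑_{α,β}`. -/
def logThreshold (N : ℕ) (ε δ s₁ s₂ : ℝ) : ℝ :=
  s₁ / (ε ^ 2 * δ) * (1 / (3 / 5) ^ N) * (1 + gFun 0 ⊤ N (√(7 / 8) * N)) + 2 * Real.log 2 +
    Real.log (ε ^ 2 * δ + 1) + Real.log (max s₂ 1)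

theorem mul_sqrt_le_two_mul_rFun {n : ℕ} (hn : 1 ≤ n) (hK : (n : ℕ∞) ≤ K) {z : ℝ} (hρ : 0 ≤ ρ)
    (hρ1 : ρ ≤ 1) (hρz : ρ ≤ z) (hρn : 1 / 2 ≤ ρ ^ n) (hz : K = ⊤ → z < 1) :
    1 / √Real.pi * eConst * (√n / 2) ≤ 2 * eConst * rFun 0 K z := by
  have hscale : rScale 0 = 1 := by simp [rScale]
  have horder : rOrder 0 = 1 / 2 := by simp [rOrder]
  rw [two_mul_rFun, hscale, horder, one_mul]
  exact mul_le_mul_of_nonneg_left (sqrt_div_two_le_polylog hn hK hρ hρ1 hρz hρn hz)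
    inv_sqrt_pi_mul_eConst_pos.le

theorem one_add_margin_mul_cOne_le (hB : B ∈ matrixSpace N) (hK : 1 ≤ K) (hρ : 9 / 10 ≤ ρ)
    (hρ' : ρ' ≤ 1) (hV : B ∈ entryBox N ρ ρ') :
    (1 + margin) * cOne K (gammaVal N) 0 B ≤
      (1 - margin) * centralSeries K (2 * gammaVal N * bMin B) := by
  have hlo := lt_four_mul_bMin hV
  have hhi := four_mul_bMax_lt hB hV
  have := mul_le_mul_of_nonneg_left (bMin_le_bMax (B := B)) (gammaVal_pos (N := N)).le
  rw [cOne_zero]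
  exact one_add_margin_mul_le_centralSeries hK (by linarith) (by linarith)

theorem one_add_margin_mul_le_cTwo (hB : B ∈ matrixSpace N) (hK : 1 ≤ K) (hρ : 9 / 10 ≤ ρ)
    (hρ' : ρ' ≤ 1) (hV : B ∈ entryBox N ρ ρ') :
    (1 + margin) * centralSeries K (2 * gammaVal N * bMax B) ≤
      (1 - margin) * cTwo K (gammaVal N) 0 B := by
  have hlo := lt_four_mul_bMin hV
  have hhi := four_mul_bMax_lt hB hV
  have := mul_le_mul_of_nonneg_left (bMin_le_bMax (B := B)) (gammaVal_pos (N := N)).le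
  rw [cTwo_zero]
  exact one_add_margin_mul_centralSeries_le hK (by linarith) (by linarith)

theorem cTwo_le_two (hB : B ∈ matrixSpace N) (hρ' : ρ' ≤ 1) (hV : B ∈ entryBox N ρ ρ') :
    cTwo K (gammaVal N) 0 B ≤ 2 := by
  have := gammaVal_pos (N := N)
  have := bMax_pos hB
  have hhi := four_mul_bMax_lt hB hV
  rw [cTwo_zero]
  exact one_add_mul_polylog_le_two (by positivity) (by linarith)

theorem cOne_lt_cTwo (hB : B ∈ matrixSpace N) (hK : 1 ≤ K) (hρ : 9 / 10 ≤ ρ)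
    (hρ' : ρ' < 1) (hV : B ∈ entryBox N ρ ρ') :
    cOne K (gammaVal N) 0 B < cTwo K (gammaVal N) 0 B := by
  have hγ := gammaVal_pos (N := N)
  have hb := bMin_pos hB
  have hhi := four_mul_bMax_lt hB hV
  have hc₂ := cTwo_pos (K := K) (q := 0) hB hγ.le
  have hm := margin_pos
  have hm₁ := sub_pos.2 margin_lt_one
  have hmono : centralSeries K (2 * gammaVal N * bMin B) ≤
      centralSeries K (2 * gammaVal N * bMax B) :=
    centralSeries_mono (by positivity)
      (mul_le_mul_of_nonneg_left bMin_le_bMax (by positivity)) (by linarith)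
  have hnonneg : 0 ≤ centralSeries K (2 * gammaVal N * bMax B) :=
    tsum_nonneg fun k => mul_nonneg (centralRatio_pos _).le
      (pow_nonneg (by have := bMax_pos hB; positivity) _)
  refine lt_of_mul_lt_mul_left ?_ (add_pos zero_lt_one hm).le
  calc (1 + margin) * cOne K (gammaVal N) 0 B
      ≤ (1 - margin) * centralSeries K (2 * gammaVal N * bMin B) :=
        one_add_margin_mul_cOne_le hB hK hρ hρ'.le hV
    _ ≤ (1 + margin) * centralSeries K (2 * gammaVal N * bMax B) :=
        (mul_le_mul_of_nonneg_left hmono hm₁.le).trans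
          (mul_le_mul_of_nonneg_right (by linarith) hnonneg)
    _ ≤ (1 - margin) * cTwo K (gammaVal N) 0 B := one_add_margin_mul_le_cTwo hB hK hρ hρ'.le hV
    _ < (1 + margin) * cTwo K (gammaVal N) 0 B := by
        gcongr
        linarith

theorem mem_matrixSubset_of_mem_entryBox {ε δ s₁ s₂ : ℝ} (hε : 0 < ε) (hδ : 0 < δ)
    (hs₁ : 0 < s₁) {n : ℕ} (hn : 1 ≤ n) (hK : (n : ℕ∞) ≤ K)
    (hlarge : Real.exp (logThreshold N ε δ s₁ s₂) ≤ 1 / √Real.pi * eConst * (√n / 2))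
    (hρ : 9 / 10 ≤ ρ) (hρn : 1 / 2 ≤ ρ ^ n) (hρ' : ρ' < 1) (hB : B ∈ matrixSpace N)
    (hV : B ∈ entryBox N ρ ρ') :
    B ∈ matrixSubset N K ε δ s₁ s₂ (gammaVal N) (gammaVal N) 0 0 := by
  have hN : (0 : ℝ) < N := by exact_mod_cast NeZero.pos N
  have hγ := gammaVal_pos (N := N)
  have hlo := lt_four_mul_bMin hV
  have hhi := four_mul_bMax_lt hB hV
  have hbb := mul_le_mul_of_nonneg_left (bMin_le_bMax (B := B)) hγ.le
  have hc₁ := one_le_cOne (K := K) (q := 0) hB hγ.le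
  have hc₂ := cTwo_pos (K := K) (q := 0) hB hγ.le
  have hcc : (cTwo K (gammaVal N) 0 B)⁻¹ < (cOne K (gammaVal N) 0 B)⁻¹ := by
    gcongr
    exact cOne_lt_cTwo hB (hK.trans' (by exact_mod_cast hn)) hρ hρ' hV
  refine ⟨hB, hcc, fun k hk _ => ?_, ?_, fun _ => ⟨by linarith, ?_⟩⟩
  · have : (0 : ℝ) < k := by exact_mod_cast hk
    gcongr
  · have hleft : s₁ / (ε ^ 2 * δ) * ((cOne K (gammaVal N) 0 B)⁻¹ / dConst B) *
        (1 + gFun 0 K N (√(2 * gammaVal N * (bMin B)⁻¹))) ≤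
        s₁ / (ε ^ 2 * δ) * (1 / (3 / 5) ^ N) * (1 + gFun 0 ⊤ N (√(7 / 8) * N)) := by
      have := gFun_nonneg (K := K) (N := N) (q := 0)
        (Real.sqrt_nonneg (2 * gammaVal N * (bMin B)⁻¹))
      have hd := le_dConst_of_mem_entryBox hB (by linarith) hρ'.le hV
      gcongr
      · exact inv_le_one_of_one_le₀ hc₁
      · exact gFun_le_of_mem_entryBox hB hρ hV 0
    have hlog2 : -Real.log 2 ≤ Real.log (cTwo K (gammaVal N) 0 B)⁻¹ := by
      rw [Real.log_inv]
      exact neg_le_neg (Real.log_le_log hc₂ (cTwo_le_two hB hρ'.le hV))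
    have hR := hlarge.trans (mul_sqrt_le_two_mul_rFun hn hK (by linarith) (by linarith) hlo.le hρn
      fun _ => by linarith)
    have hlog := Real.log_le_log (Real.exp_pos _) (hR.trans (le_add_of_nonneg_left zero_le_one))
    rw [Real.log_exp, logThreshold] at hlog
    have : 0 < s₁ / (ε ^ 2 * δ) := by positivity
    linarith
  · nlinarith [two_mul_inv_bMin_le hB hρ hV]

theorem exists_mem_entryBox (hρ : 0 < ρ) (hρρ : ρ < ρ') (hρ' : ρ' < 1) :
    ∃ B ∈ matrixSpace N, B ∈ entryBox N ρ ρ' := by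
  have hN : (0 : ℝ) < N := by exact_mod_cast NeZero.pos N
  obtain ⟨b, hb, hb'⟩ : ∃ b, 4 / (5 * N) * ρ < b ∧ b < 4 / (5 * N) * ρ' :=
    exists_between (by gcongr)
  obtain ⟨c, hc, hc'⟩ := exists_between hb'
  have hb0 : 0 < b := hb.trans' (by positivity)
  let B : Matrix (Fin N) (Fin N) ℝ := b • Matrix.vecMulVec 1 (star 1) + (c - b) • 1
  have hentry (i j : Fin N) : B i j = if i = j then c else b := by
    simp only [B, Matrix.add_apply, Matrix.smul_apply, Matrix.vecMulVec_apply, Matrix.one_apply]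
    split_ifs <;> simp
  have hV : B ∈ entryBox N ρ ρ' := fun i j => by
    rw [hentry]
    split_ifs
    exacts [⟨hb.trans hc, hc'⟩, ⟨hb, hb'⟩]
  have hpos (i j : Fin N) : 0 < B i j := (hV i j).1.trans' (by positivity)
  have hdef : B.PosDef := Matrix.PosDef.posSemidef_add
    ((Matrix.posSemidef_vecMulVec_self_star 1).smul hb0.le)
    (Matrix.PosDef.one.smul (sub_pos.2 hc))
  refine ⟨B, ⟨hpos, Matrix.IsSymm.ext fun i j => by simp only [hentry, eq_comm],
    fun l hl => ⟨spectrum_pos_of_posDef hdef hl, ?_⟩⟩, hV⟩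
  have hle := abs_le_of_mem_spectrum
    (fun i j => ((abs_of_pos (hpos i j)).trans_lt (hV i j).2).le) hl
  rw [show (N : ℝ) * (4 / (5 * N) * ρ') = 4 / 5 * ρ' by field_simp] at hle
  linarith [le_abs_self l]

end EntryBox

section CoeffBox

variable {N : ℕ} {K : ℕ∞} {B : Matrix (Fin N) (Fin N) ℝ} {a : Coeff N K} {γ c η : ℝ}

theorem pow_div_factorial_mul_eq (γ b : ℝ) (k : ℕ) :
    γ ^ k / (k ! : ℝ) * (b ^ k * (2 * k - 1)‼) = centralRatio k * (2 * γ * b) ^ k := by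
  rw [doubleFactorial_eq_centralRatio_mul, mul_pow, mul_pow]
  field_simp

theorem summable_muTerm_and_muHaf_le [NeZero N] (hB : B ∈ matrixSpace N) (ha : Nonneg a)
    (hγ : 0 ≤ γ) (hz : 2 * γ * bMax B < 1)
    (hk : ∀ k : Level K, ∑ I, a k I ≤ c * (γ ^ k.1 / (k.1 ! : ℝ))) :
    Summable (muTerm a B) ∧ muHaf a B ≤ c * centralSeries K (2 * γ * bMax B) := by
  have := bMax_pos hB
  have hs := (summable_centralSeries (K := K) (by positivity) hz).mul_left c
  have hle (k : Level K) :
      muTerm a B k ≤ c * (centralRatio k.1 * (2 * γ * bMax B) ^ k.1) := by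
    rw [← pow_div_factorial_mul_eq, ← mul_assoc]
    exact (muTerm_le (fun i j => (hB.1 i j).le) (le_bMax B) ha k).trans
      (mul_le_mul_of_nonneg_right (hk k) (by positivity))
  have hμ := hs.of_nonneg_of_le (muTerm_nonneg hB ha) hle
  refine ⟨hμ, ?_⟩
  rw [centralSeries, ← tsum_mul_left]
  exact hμ.tsum_le_tsum hle hs

theorem mul_centralSeries_le_muHaf [NeZero N] (hB : B ∈ matrixSpace N) (ha : Nonneg a)
    (hμ : Summable (muTerm a B)) (hγ : 0 ≤ γ) (hz : 2 * γ * bMin B < 1)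
    (hk : ∀ k : Level K, c * (γ ^ k.1 / (k.1 ! : ℝ)) ≤ ∑ I, a k I) :
    c * centralSeries K (2 * γ * bMin B) ≤ muHaf a B := by
  have hb := bMin_pos hB
  have hs := (summable_centralSeries (K := K) (by positivity) hz).mul_left c
  rw [centralSeries, ← tsum_mul_left]
  refine hs.tsum_le_tsum (fun k => ?_) hμ
  rw [← pow_div_factorial_mul_eq, ← mul_assoc]
  exact (mul_le_mul_of_nonneg_right (hk k) (by positivity)).trans
    (le_muTerm hb.le (bMin_le B) ha k)

/-- The families on level `k` whose sums in the conditions on the coefficients are within a factor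
`1 ± η` of `γ^k / k!`, resp. at most `(1 + η) m_k γ^k / k!`. -/
def levelBox (N k : ℕ) (γ η : ℝ) : Set (Idx N k → ℝ) :=
  {x | (1 - η) * (γ ^ k / (k ! : ℝ)) < ∑ I, x I ∧
    ∑ I, x I < (1 + η) * (γ ^ k / (k ! : ℝ)) ∧
    ∑ I, x I * multiFactorial I.1 < (1 + η) * (γ ^ k / (k ! : ℝ)) * mIdx N k}

theorem isOpen_levelBox (N k : ℕ) (γ η : ℝ) : IsOpen (levelBox N k γ η) := by
  have h1 : Continuous fun x : Idx N k → ℝ => ∑ I, x I := by fun_prop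
  have h2 : Continuous fun x : Idx N k → ℝ => ∑ I, x I * multiFactorial I.1 := by fun_prop
  exact (isOpen_lt continuous_const h1).inter
    ((isOpen_lt h1 continuous_const).inter (isOpen_lt h2 continuous_const))

/-- The coefficient families with all levels in `levelBox`. -/
def coeffBox (N : ℕ) (K : ℕ∞) (γ η : ℝ) : Set (Coeff N K) :=
  {a | ∀ k : Level K, a k ∈ levelBox N k.1 γ η}

theorem isOpen_coeffBox (N : ℕ) (K : ℕ∞) (γ η : ℝ) : IsOpen (coeffBox N K γ η) := by
  refine TopologicalSpace.isOpen_generateFrom_of_mem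
    ⟨fun k => levelBox N k.1 γ η, fun k => isOpen_levelBox N k.1 γ η, ?_⟩
  ext a
  exact ⟨fun h k _ => h k, fun h k => h k (Set.mem_univ k)⟩

theorem coeffConditions_of_mem_coeffBox [NeZero N] (hB : B ∈ matrixSpace N) (ha : Nonneg a)
    (hγ : 0 < γ) (hη : η ≤ 1) (hz : 2 * γ * bMax B < 1)
    (h₁ : (1 + η) * cOne K γ 0 B ≤ (1 - η) * centralSeries K (2 * γ * bMin B))
    (h₂ : (1 + η) * centralSeries K (2 * γ * bMax B) ≤ (1 - η) * cTwo K γ 0 B)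
    (hU : a ∈ coeffBox N K γ η) : CoeffConditions γ γ 0 0 a B := by
  have hz' : 2 * γ * bMin B < 1 := hz.trans_le' (by gcongr; exact bMin_le_bMax)
  obtain ⟨hμ, hμle⟩ := summable_muTerm_and_muHaf_le hB ha hγ.le hz fun k => (hU k).2.1.le
  have hleμ := mul_centralSeries_le_muHaf hB ha hμ hγ.le hz' fun k => (hU k).1.le
  have hlo : (cTwo K γ 0 B)⁻¹ * muHaf a B ≤ 1 - η := by
    rw [inv_mul_le_iff₀ (cTwo_pos hB hγ.le), mul_comm (cTwo K γ 0 B)]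
    exact hμle.trans h₂
  have hhi : 1 + η ≤ (cOne K γ 0 B)⁻¹ * muHaf a B := by
    rw [le_inv_mul_iff₀ (cOne_pos hB hγ.le), mul_comm]
    exact h₁.trans hleμ
  obtain ⟨h0, h0', -⟩ := hU ⟨0, by simp⟩
  rw [sum_coeff_zero, pow_zero, Nat.factorial_zero, Nat.cast_one, div_one, mul_one] at h0 h0'
  have h0pos : 0 < coeffZero a := h0.trans_le' (sub_nonneg.2 hη)
  refine ⟨⟨_, _, h0pos.ne'⟩, hlo.trans_lt h0, h0'.trans_le hhi, fun k _ => ?_⟩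
  obtain ⟨hk₁, hk₂, hk₃⟩ := hU k
  have := (mIdx_pos (N := N) (k := k.1)).le
  rw [Real.rpow_zero, one_mul]
  refine ⟨hk₁.le.trans' ?_, hk₂.le.trans ?_, hk₃.le.trans ?_⟩ <;> gcongr

/-- The multi-index of weight `2k` with `r_k` entries `s_k + 1` and the others `s_k`. It minimises
`I!`. -/
def balancedIdx (N k : ℕ) (i : Fin N) : ℕ := sIdx N k + if (i : ℕ) < rIdx N k then 1 else 0

theorem card_filter_lt_rIdx [NeZero N] (k : ℕ) : #{i : Fin N | (i : ℕ) < rIdx N k} = rIdx N k := by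
  rw [Fin.card_filter_val_lt, min_eq_right rIdx_le]

theorem sum_balancedIdx [NeZero N] (k : ℕ) : ∑ i, balancedIdx N k i = 2 * k := by
  simp only [balancedIdx, sum_add_distrib, sum_const, card_univ, Fintype.card_fin, smul_eq_mul]
  rw [← card_filter, card_filter_lt_rIdx, ← two_mul_eq_mul_sIdx_add_rIdx]

theorem multiFactorial_balancedIdx [NeZero N] (k : ℕ) :
    multiFactorial (balancedIdx N k) = mIdx N k := by
  have h (i : Fin N) : ((balancedIdx N k i)! : ℝ) =
      (sIdx N k)! * if (i : ℕ) < rIdx N k then (sIdx N k : ℝ) + 1 else 1 := by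
    unfold balancedIdx
    split_ifs
    · rw [Nat.factorial_succ]
      push_cast
      ring
    · simp
  rw [multiFactorial, prod_congr rfl fun i _ => h i, prod_mul_distrib, prod_const, card_univ,
    Fintype.card_fin, prod_ite, prod_const, prod_const_one, mul_one, card_filter_lt_rIdx, mIdx]

/-- The family `a_I = γ^k / k!` for `I = balancedIdx N k`, and `a_I = 0` otherwise. -/
def balancedCoeff (N : ℕ) [NeZero N] (K : ℕ∞) (γ : ℝ) : Coeff N K := fun k I =>
  if I = ⟨balancedIdx N k.1, sum_balancedIdx k.1⟩ then γ ^ k.1 / (k.1 ! : ℝ) else 0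

theorem balancedCoeff_nonneg [NeZero N] (hγ : 0 ≤ γ) : Nonneg (balancedCoeff N K γ) := fun k I => by
  unfold balancedCoeff
  split_ifs <;> positivity

theorem balancedCoeff_mem_coeffBox [NeZero N] (hγ : 0 < γ) (hη : 0 < η) :
    balancedCoeff N K γ ∈ coeffBox N K γ η := fun k => by
  have hg : 0 < γ ^ k.1 / (k.1 ! : ℝ) := by positivity
  have hm := mIdx_pos (N := N) (k := k.1)
  have hηg := mul_pos hη hg
  simp only [levelBox, balancedCoeff, Set.mem_ofPred_eq, ite_mul, zero_mul, sum_ite_eq', mem_univ,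
    if_true, multiFactorial_balancedIdx]
  exact ⟨by linarith, by linarith, by linarith [mul_pos hηg hm]⟩

end CoeffBox

section OpenSet

open Filter Topology

theorem exists_le_mul_sqrt_div_two {c : ℝ} (hc : 0 < c) (M : ℝ) :
    ∃ n : ℕ, 1 ≤ n ∧ M ≤ c * (√n / 2) :=
  ((eventually_ge_atTop 1).and <|
    (((Real.tendsto_sqrt_atTop.comp tendsto_natCast_atTop_atTop).atTop_div_const
      two_pos).const_mul_atTop hc).eventually_ge_atTop M).exists

theorem exists_lt_one_half_le_pow (n : ℕ) : ∃ ρ : ℝ, 9 / 10 ≤ ρ ∧ ρ < 1 ∧ 1 / 2 ≤ ρ ^ n := by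
  have hpow : Tendsto (fun ρ : ℝ => ρ ^ n) (𝓝[<] 1) (𝓝 1) := by
    simpa using ((continuous_pow n).tendsto (1 : ℝ)).mono_left nhdsWithin_le_nhds
  have hIco : ∀ᶠ ρ in 𝓝[<] (1 : ℝ), ρ ∈ Set.Ico (9 / 10) 1 := Ico_mem_nhdsLT (by norm_num)
  obtain ⟨ρ, hρ, hle⟩ := (hIco.and (hpow.eventually_const_le one_half_lt_one)).exists
  exact ⟨ρ, hρ.1, hρ.2, hle⟩

theorem exists_isOpen_forall_mem_matrixSubset_and_coeffConditions (N : ℕ) [NeZero N]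
    {ε δ s₁ : ℝ} (hε : 0 < ε) (hδ : 0 < δ) (hs₁ : 0 < s₁) (s₂ : ℝ) :
    ∃ K₀ : ℕ, ∀ K : ℕ∞, (K₀ : ℕ∞) ≤ K → ∃ γα γβ qα qβ : ℝ, 0 < γα ∧ 0 < γβ ∧
      ∃ U : Set (problemSpace N K), IsOpen U ∧ U.Nonempty ∧
        ∀ p ∈ U, p.1.2 ∈ matrixSubset N K ε δ s₁ s₂ γα γβ qα qβ ∧
          CoeffConditions γα γβ qα qβ p.1.1 p.1.2 := by
  have hγ := gammaVal_pos (N := N)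
  obtain ⟨n, hn, hlarge⟩ := exists_le_mul_sqrt_div_two inv_sqrt_pi_mul_eConst_pos
    (Real.exp (logThreshold N ε δ s₁ s₂))
  refine ⟨n, fun K hK => ⟨gammaVal N, gammaVal N, 0, 0, hγ, hγ, ?_⟩⟩
  have hK1 : 1 ≤ K := hK.trans' (by exact_mod_cast hn)
  obtain ⟨ρ, hρ, hρ1, hρn⟩ := exists_lt_one_half_le_pow n
  obtain ⟨ρ', hρρ, hρ'⟩ := exists_between hρ1
  have hmatrix (B) (hB : B ∈ matrixSpace N) (hV : B ∈ entryBox N ρ ρ') :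
      B ∈ matrixSubset N K ε δ s₁ s₂ (gammaVal N) (gammaVal N) 0 0 :=
    mem_matrixSubset_of_mem_entryBox hε hδ hs₁ hn hK hlarge hρ hρn hρ' hB hV
  have hcoeff (a : Coeff N K) (B) (ha : Nonneg a) (hU : a ∈ coeffBox N K (gammaVal N) margin)
      (hB : B ∈ matrixSpace N) (hV : B ∈ entryBox N ρ ρ') :
      CoeffConditions (gammaVal N) (gammaVal N) 0 0 a B := by
    have hhi := four_mul_bMax_lt hB hV
    have := mul_pos hγ (bMax_pos hB)
    exact coeffConditions_of_mem_coeffBox hB ha hγ margin_lt_one.le (by linarith)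
      (one_add_margin_mul_cOne_le hB hK1 hρ hρ'.le hV)
      (one_add_margin_mul_le_cTwo hB hK1 hρ hρ'.le hV) hU
  refine ⟨Subtype.val ⁻¹' (coeffBox N K (gammaVal N) margin ×ˢ entryBox N ρ ρ'),
    ((isOpen_coeffBox N K _ _).prod (isOpen_entryBox N ρ ρ')).preimage continuous_subtype_val, ?_,
    fun p hp => ⟨hmatrix _ p.2.1 hp.2, hcoeff _ _ p.2.2.1 hp.1 p.2.1 hp.2⟩⟩
  obtain ⟨B, hB, hV⟩ := exists_mem_entryBox (N := N) (by linarith) hρρ hρ'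
  have ha := balancedCoeff_nonneg (N := N) (K := K) hγ.le
  have hU := balancedCoeff_mem_coeffBox (N := N) (K := K) hγ margin_pos
  exact ⟨⟨(balancedCoeff N K (gammaVal N), B), hB,
    (mem_coeffSpace_and_mul_exp_nGBSP_lt_nMC hε hδ hs₁ hγ hγ (hmatrix B hB hV) ha
      (hcoeff _ B ha hU hB hV)).1⟩, hU, hV⟩

end OpenSet

end GaussExp

end

theorem mainTheorem4_general (N : ℕ) (hN : 1 ≤ N) (ε δ s₁ s₂ : ℝ) (hε : 0 < ε)
    (hδ : 0 < δ) (hs₁ : 0 < s₁) :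
    (∀ (K : ℕ∞) (γα γβ qα qβ : ℝ), 0 < γα → 0 < γβ →
      ∀ B ∈ GaussExp.matrixSubset N K ε δ s₁ s₂ γα γβ qα qβ,
      ∀ a : GaussExp.Coeff N K, GaussExp.Nonneg a →
        GaussExp.CoeffConditions γα γβ qα qβ a B →
        a ∈ GaussExp.coeffSpace K B ∧
        s₂ * Real.exp (s₁ * GaussExp.nGBSP ε δ a B) < GaussExp.nMC ε δ a B) ∧
    (∃ K₀ : ℕ, ∀ K : ℕ∞, (K₀ : ℕ∞) ≤ K →
      ∃ γα γβ qα qβ : ℝ, 0 < γα ∧ 0 < γβ ∧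
        ∃ U : Set (GaussExp.problemSpace N K), IsOpen U ∧ U.Nonempty ∧
          ∀ p ∈ U, p.1.2 ∈ GaussExp.matrixSubset N K ε δ s₁ s₂ γα γβ qα qβ ∧
            GaussExp.CoeffConditions γα γβ qα qβ p.1.1 p.1.2) := by
  have : NeZero N := ⟨by omega⟩
  exact ⟨fun _ _ _ _ _ hα hβ _ hB _ ha h =>
    GaussExp.mem_coeffSpace_and_mul_exp_nGBSP_lt_nMC hε hδ hs₁ hα hβ hB ha h,
    GaussExp.exists_isOpen_forall_mem_matrixSubset_and_coeffConditions N hε hδ hs₁ s₂⟩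

theorem mainTheorem4 (N : ℕ) (hN : 1 ≤ N) (ε δ s₁ s₂ : ℝ) (hε : 0 < ε) (hε' : ε < 1)
    (hδ : 0 < δ) (hδ' : δ < 1) (hs₁ : 0 < s₁) (hs₂ : 0 < s₂) :
    (∀ (K : ℕ∞) (γα γβ qα qβ : ℝ), 0 < γα → 0 < γβ →
      ∀ B ∈ GaussExp.matrixSubset N K ε δ s₁ s₂ γα γβ qα qβ,
      ∀ a : GaussExp.Coeff N K, GaussExp.Nonneg a →
        GaussExp.CoeffConditions γα γβ qα qβ a B →
        a ∈ GaussExp.coeffSpace K B ∧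
        s₂ * Real.exp (s₁ * GaussExp.nGBSP ε δ a B) < GaussExp.nMC ε δ a B) ∧
    (∃ K₀ : ℕ, ∀ K : ℕ∞, (K₀ : ℕ∞) ≤ K →
      ∃ γα γβ qα qβ : ℝ, 0 < γα ∧ 0 < γβ ∧
        ∃ U : Set (GaussExp.problemSpace N K), IsOpen U ∧ U.Nonempty ∧
          ∀ p ∈ U, p.1.2 ∈ GaussExp.matrixSubset N K ε δ s₁ s₂ γα γβ qα qβ ∧
            GaussExp.CoeffConditions γα γβ qα qβ p.1.1 p.1.2) :=
  mainTheorem4_general N hN ε δ s₁ s₂ hε hδ hs₁
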